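/- Let $D$ be a metric space that is uniformly discrete (there is $\varepsilon>0$ with $d(x,y)\ge\varepsilon$ for all $x\ne y$ in $D$) and has bounded geometry (for every $R>0$ the number of points in the balls of radius $R$ is uniformly bounded). Suppose that $D$ satisfies at least one of the following two conditions: 1. there is $\alpha>0$ such that the graph $D(\alpha)$, whose vertices are the points of $D$ and in which two distinct points $x,y$ are joined by an edge if and only if $d(x,y)\le\alpha$, has no finite connected components; 2. there are a discrete proper metric space $D'$ with a ray structure, and an isometric inclusion $D\subset D'$ which is a coarse equivalence, i.e. there is $C>0$ such that every $x\in D'$ satisfies $d(x,y)<C$ for some $y\in D$. (Proper means that all closed balls are compact. A ray structure on $D'$ is a partition $D'=\bigsqcup_{i\in I}D'_i$ together with bijections $\beta_i:\mathbb N\to D'_i$, $i\in I$, that are Lipschitz with a common constant.) For a complex Hilbert space $H$ let $C^*_H(D)$ be the Roe algebra: the norm closure in $\mathbb B(\ell^2(D)\otimes H)$ of the $*$-algebra of all operators $T$ that are locally compact ($Tf$ and $fT$ are compact for every $f\in C_0(D)$, acting by multiplication) and have finite propagation (for some $R>0$, $fTg=0$ whenever $f,g\in C_0(D)$ have supports at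 distance greater than $R$). For $H=\mathbb C$ this is the uniform Roe algebra $C^*_{\mathbb C}(D)$, which is unital. Let $H$ be an infinite-dimensional complex Hilbert space, let $V:\mathbb C\to H$ be an isometry, set $V_D=\mathrm{id}\otimes V:\ell^2(D)\to\ell^2(D)\otimes H$, and let $i_D:C^*_{\mathbb C}(D)\to C^*_H(D)$ be the $*$-homomorphism $i_D(T)=V_DTV_D^*$. Then the induced map $(i_D)_*:K_0(C^*_{\mathbb C}(D))\to K_0(C^*_H(D))$ satisfies $$(i_D)_*([1])=0 .$$ -/

import Mathlib

open scoped Matrix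

namespace CoarseK

section KTheory

/-- Murray--von Neumann equivalence of square matrices `p`, `q` (of possibly different sizes) over
a star ring: there is a rectangular `v` with `v* v = p` and `v v* = q`. -/
def MvN {A : Type*} [Ring A] [StarRing A] {m n : Type*} [Fintype m] [Fintype n]
    (p : Matrix m m A) (q : Matrix n n A) : Prop :=
  ∃ v : Matrix n m A, vᴴ * v = p ∧ v * vᴴ = q

theorem MvN.refl {A : Type*} [Ring A] [StarRing A] {m : Type*} [Fintype m]
    {p : Matrix m m A} (hp : IsStarProjection p) : MvN p p := by
  have h1 : pᴴ = p := hp.isSelfAdjoint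
  have h2 : p * p = p := hp.isIdempotentElem
  exact ⟨p, by rw [h1, h2], by rw [h1, h2]⟩

theorem MvN.symm {A : Type*} [Ring A] [StarRing A] {m n : Type*} [Fintype m] [Fintype n]
    {p : Matrix m m A} {q : Matrix n n A} (h : MvN p q) : MvN q p := by
  obtain ⟨v, h1, h2⟩ := h
  exact ⟨vᴴ, by simpa using h2, by simpa using h1⟩

theorem MvN.trans {A : Type*} [Ring A] [StarRing A] {l m n : Type*} [Fintype l] [Fintype m]
    [Fintype n] {p : Matrix l l A} {q : Matrix m m A} {r : Matrix n n A}
    (hp : IsStarProjection p) (hr : IsStarProjection r) (h : MvN p q) (h' : MvN q r) :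
    MvN p r := by
  obtain ⟨v, h1, h2⟩ := h
  obtain ⟨w, h3, h4⟩ := h'
  have hp2 : p * p = p := hp.isIdempotentElem
  have hr2 : r * r = r := hr.isIdempotentElem
  refine ⟨w * v, ?_, ?_⟩
  · calc (w * v)ᴴ * (w * v) = vᴴ * (wᴴ * w) * v := by
          simp only [Matrix.conjTranspose_mul, Matrix.mul_assoc]
      _ = (vᴴ * v) * (vᴴ * v) := by rw [h3, ← h2]; simp only [Matrix.mul_assoc]
      _ = p := by rw [h1, hp2]
  · calc (w * v) * (w * v)ᴴ = w * (v * vᴴ) * wᴴ := by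
          simp only [Matrix.conjTranspose_mul, Matrix.mul_assoc]
      _ = (w * wᴴ) * (w * wᴴ) := by rw [h2, ← h3]; simp only [Matrix.mul_assoc]
      _ = r := by rw [h4, hr2]

theorem MvN.blocks {A : Type*} [Ring A] [StarRing A] {m n m' n' : Type*} [Fintype m] [Fintype n]
    [Fintype m'] [Fintype n'] {p : Matrix m m A} {q : Matrix n n A} {p' : Matrix m' m' A}
    {q' : Matrix n' n' A} (h : MvN p q) (h' : MvN p' q') :
    MvN (Matrix.fromBlocks p 0 0 p') (Matrix.fromBlocks q 0 0 q') := by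
  obtain ⟨v, h1, h2⟩ := h
  obtain ⟨w, h3, h4⟩ := h'
  refine ⟨Matrix.fromBlocks v 0 0 w, ?_, ?_⟩ <;>
    simp [Matrix.fromBlocks_conjTranspose, Matrix.fromBlocks_multiply, h1, h2, h3, h4]

theorem MvN.submatrix {A : Type*} [Ring A] [StarRing A] {m n : Type*} [Fintype m] [Fintype n]
    {p : Matrix m m A} (hp : IsStarProjection p) (e : n ≃ m) : MvN p (p.submatrix e e) := by
  have h1 : pᴴ = p := hp.isSelfAdjoint
  have h2 : p * p = p := hp.isIdempotentElem
  refine ⟨p.submatrix e id, ?_, ?_⟩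
  · rw [Matrix.conjTranspose_submatrix, h1, Matrix.submatrix_mul_equiv, h2, Matrix.submatrix_id_id]
  · rw [Matrix.conjTranspose_submatrix, h1,
      ← Matrix.submatrix_mul p p e id e Function.bijective_id, h2]

theorem isStarProjection_blocks {A : Type*} [Ring A] [StarRing A] {m n : Type*} [Fintype m]
    [Fintype n] {p : Matrix m m A} {q : Matrix n n A} (hp : IsStarProjection p)
    (hq : IsStarProjection q) : IsStarProjection (Matrix.fromBlocks p 0 0 q) := by
  have h1 : pᴴ = p := hp.isSelfAdjoint
  have h2 : p * p = p := hp.isIdempotentElem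
  have h3 : qᴴ = q := hq.isSelfAdjoint
  have h4 : q * q = q := hq.isIdempotentElem
  constructor
  · simp [IsIdempotentElem, Matrix.fromBlocks_multiply, h2, h4]
  · simp [IsSelfAdjoint, Matrix.star_eq_conjTranspose, Matrix.fromBlocks_conjTranspose, h1, h3]

theorem isStarProjection_submatrix {A : Type*} [Ring A] [StarRing A] {m n : Type*} [Fintype m]
    [Fintype n] {p : Matrix m m A} (hp : IsStarProjection p) (e : n ≃ m) :
    IsStarProjection (p.submatrix e e) := by
  have h1 : pᴴ = p := hp.isSelfAdjoint
  have h2 : p * p = p := hp.isIdempotentElem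
  constructor
  · rw [IsIdempotentElem, Matrix.submatrix_mul_equiv, h2]
  · rw [IsSelfAdjoint, Matrix.star_eq_conjTranspose, Matrix.conjTranspose_submatrix, h1]

theorem conjTranspose_map_hom {A B : Type*} [Ring A] [StarRing A] [Algebra ℂ A]
    [Ring B] [StarRing B] [Algebra ℂ B] (φ : A →⋆ₐ[ℂ] B) {m n : Type*} (v : Matrix m n A) :
    (v.map φ)ᴴ = vᴴ.map φ := by
  ext i j
  exact (map_star φ (v j i)).symm

theorem isStarProjection_map {A B : Type*} [Ring A] [StarRing A] [Algebra ℂ A]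
    [Ring B] [StarRing B] [Algebra ℂ B] (φ : A →⋆ₐ[ℂ] B) {m : Type*} [Fintype m]
    {p : Matrix m m A} (hp : IsStarProjection p) : IsStarProjection (p.map φ) := by
  have h1 : pᴴ = p := hp.isSelfAdjoint
  have h2 : p * p = p := hp.isIdempotentElem
  constructor
  · rw [IsIdempotentElem, ← Matrix.map_mul, h2]
  · rw [IsSelfAdjoint, Matrix.star_eq_conjTranspose, conjTranspose_map_hom, h1]

/-- The projections in the matrix algebras `M_n(A)`, `n = 0, 1, 2, …`. -/
structure MatProj (A : Type*) [Ring A] [StarRing A] where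
  size : ℕ
  mat : Matrix (Fin size) (Fin size) A
  isProj : IsStarProjection mat

/-- Murray--von Neumann equivalence on `⋃ₙ Proj M_n(A)`. -/
instance MatProj.setoid (A : Type*) [Ring A] [StarRing A] : Setoid (MatProj A) where
  r p q := MvN p.mat q.mat
  iseqv := ⟨fun p => MvN.refl p.isProj, fun h => h.symm,
    fun {p _ r} h h' => MvN.trans p.isProj r.isProj h h'⟩

/-- The block diagonal sum `p ⊕ q`. -/
def MatProj.sum {A : Type*} [Ring A] [StarRing A] (p q : MatProj A) : MatProj A where
  size := p.size + q.size
  mat := (Matrix.fromBlocks p.mat 0 0 q.mat).submatrix finSumFinEquiv.symm finSumFinEquiv.symm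
  isProj := isStarProjection_submatrix (isStarProjection_blocks p.isProj q.isProj) _

theorem MatProj.sum_mvn {A : Type*} [Ring A] [StarRing A] (p q : MatProj A) :
    MvN (Matrix.fromBlocks p.mat 0 0 q.mat) (p.sum q).mat :=
  MvN.submatrix (isStarProjection_blocks p.isProj q.isProj) _

/-- The zero projection, of size `0`. -/
def MatProj.zero (A : Type*) [Ring A] [StarRing A] : MatProj A where
  size := 0
  mat := 0
  isProj := IsStarProjection.zero _

/-- The image of a projection under a unital `*`-homomorphism, applied entrywise. -/
def MatProj.map {A B : Type*} [Ring A] [StarRing A] [Algebra ℂ A]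
    [Ring B] [StarRing B] [Algebra ℂ B] (φ : A →⋆ₐ[ℂ] B) (p : MatProj A) : MatProj B where
  size := p.size
  mat := p.mat.map φ
  isProj := isStarProjection_map φ p.isProj

/-- The semigroup `V(A)` of Murray--von Neumann classes of projections over `A`. -/
def VMon (A : Type*) [Ring A] [StarRing A] : Type _ := Quotient (MatProj.setoid A)

/-- The class of a projection in `V(A)`. -/
def VMon.mk {A : Type*} [Ring A] [StarRing A] (p : MatProj A) : VMon A :=
  Quotient.mk (MatProj.setoid A) p

theorem VMon.sound {A : Type*} [Ring A] [StarRing A] {p q : MatProj A}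
    (h : MvN p.mat q.mat) : VMon.mk p = VMon.mk q :=
  Quotient.sound h

theorem MatProj.sum_congr {A : Type*} [Ring A] [StarRing A] {p q p' q' : MatProj A}
    (h : MvN p.mat p'.mat) (h' : MvN q.mat q'.mat) : MvN (p.sum q).mat (p'.sum q').mat := by
  have hb := isStarProjection_blocks p.isProj q.isProj
  have hb' := isStarProjection_blocks p'.isProj q'.isProj
  exact MvN.trans (p.sum q).isProj (p'.sum q').isProj (MvN.symm (p.sum_mvn q))
    (MvN.trans hb (p'.sum q').isProj (h.blocks h') (p'.sum_mvn q'))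

/-- Addition on `V(A)` is induced by the block diagonal sum. -/
instance VMon.instAdd (A : Type*) [Ring A] [StarRing A] : Add (VMon A) where
  add := Quotient.map₂ MatProj.sum (fun _ _ h _ _ h' => MatProj.sum_congr h h')

instance VMon.instZero (A : Type*) [Ring A] [StarRing A] : Zero (VMon A) where
  zero := VMon.mk (MatProj.zero A)

instance VMon.instAddCommMonoid (A : Type*) [Ring A] [StarRing A] : AddCommMonoid (VMon A) where
  nsmul := nsmulRec
  add_assoc := by
    rintro ⟨p⟩ ⟨q⟩ ⟨r⟩
    refine VMon.sound (p := (p.sum q).sum r) (q := p.sum (q.sum r)) ?_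
    have hp := p.isProj
    have hq := q.isProj
    have hr := r.isProj
    have h1 : MvN (Matrix.fromBlocks (Matrix.fromBlocks p.mat 0 0 q.mat) 0 0 r.mat)
        ((p.sum q).sum r).mat :=
      MvN.trans (isStarProjection_blocks (isStarProjection_blocks hp hq) hr) (MatProj.isProj _)
        (MvN.blocks (p.sum_mvn q) (MvN.refl hr)) ((p.sum q).sum_mvn r)
    have h2 : MvN (Matrix.fromBlocks p.mat 0 0 (Matrix.fromBlocks q.mat 0 0 r.mat))
        (p.sum (q.sum r)).mat :=
      MvN.trans (isStarProjection_blocks hp (isStarProjection_blocks hq hr)) (MatProj.isProj _)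
        (MvN.blocks (MvN.refl hp) (q.sum_mvn r)) (p.sum_mvn (q.sum r))
    have h3 := MvN.submatrix
      (isStarProjection_blocks hp (isStarProjection_blocks hq hr)) (Equiv.sumAssoc _ _ _)
    have h4 : (Matrix.fromBlocks p.mat 0 0 (Matrix.fromBlocks q.mat 0 0 r.mat)).submatrix
        (Equiv.sumAssoc _ _ _) (Equiv.sumAssoc _ _ _) =
        Matrix.fromBlocks (Matrix.fromBlocks p.mat 0 0 q.mat) 0 0 r.mat := by
      ext ((i | i) | i) ((j | j) | j) <;> simp
    rw [h4] at h3
    exact MvN.trans (MatProj.isProj _) (MatProj.isProj _) h1.symm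
      (MvN.trans (isStarProjection_blocks (isStarProjection_blocks hp hq) hr)
        (MatProj.isProj _) h3.symm h2)
  zero_add := by
    rintro ⟨p⟩
    refine VMon.sound (p := (MatProj.zero A).sum p) (q := p) ?_
    have h3 := MvN.submatrix
      (isStarProjection_blocks (MatProj.zero A).isProj p.isProj) (Equiv.emptySum (Fin 0) _).symm
    have h4 : (Matrix.fromBlocks (MatProj.zero A).mat 0 0 p.mat).submatrix
        (Equiv.emptySum (Fin 0) _).symm (Equiv.emptySum (Fin 0) _).symm = p.mat := by
      rfl
    exact MvN.trans (MatProj.isProj _) p.isProj ((MatProj.zero A).sum_mvn p).symm (h4 ▸ h3)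
  add_zero := by
    rintro ⟨p⟩
    refine VMon.sound (p := p.sum (MatProj.zero A)) (q := p) ?_
    have h3 := MvN.submatrix
      (isStarProjection_blocks p.isProj (MatProj.zero A).isProj) (Equiv.sumEmpty _ (Fin 0)).symm
    have h4 : (Matrix.fromBlocks p.mat 0 0 (MatProj.zero A).mat).submatrix
        (Equiv.sumEmpty _ (Fin 0)).symm (Equiv.sumEmpty _ (Fin 0)).symm = p.mat := by
      rfl
    exact MvN.trans (MatProj.isProj _) p.isProj (p.sum_mvn (MatProj.zero A)).symm (h4 ▸ h3)
  add_comm := by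
    rintro ⟨p⟩ ⟨q⟩
    refine VMon.sound (p := p.sum q) (q := q.sum p) ?_
    have h3 := MvN.submatrix
      (isStarProjection_blocks p.isProj q.isProj) (Equiv.sumComm _ _)
    have h4 : (Matrix.fromBlocks p.mat 0 0 q.mat).submatrix
        (Equiv.sumComm _ _) (Equiv.sumComm _ _) = Matrix.fromBlocks q.mat 0 0 p.mat := by
      ext (i | i) (j | j) <;> simp
    rw [h4] at h3
    exact MvN.trans (MatProj.isProj _) (MatProj.isProj _) (p.sum_mvn q).symm
      (MvN.trans (isStarProjection_blocks p.isProj q.isProj) (MatProj.isProj _) h3 (q.sum_mvn p))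

/-- Functoriality of `V`. -/
def VMon.map {A B : Type*} [Ring A] [StarRing A] [Algebra ℂ A]
    [Ring B] [StarRing B] [Algebra ℂ B] (φ : A →⋆ₐ[ℂ] B) : VMon A →+ VMon B where
  toFun := Quotient.map (MatProj.map φ) (by
    rintro p q ⟨v, h1, h2⟩
    refine ⟨v.map φ, ?_, ?_⟩
    · change (v.map φ)ᴴ * v.map φ = p.mat.map φ
      rw [conjTranspose_map_hom, ← Matrix.map_mul, h1]
    · change v.map φ * (v.map φ)ᴴ = q.mat.map φ
      rw [conjTranspose_map_hom, ← Matrix.map_mul, h2])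
  map_zero' := by
    refine VMon.sound (p := (MatProj.zero A).map φ) (q := MatProj.zero B) ⟨0, ?_, ?_⟩ <;>
      · ext i
        exact Fin.elim0 i
  map_add' := by
    rintro ⟨p⟩ ⟨q⟩
    refine congrArg VMon.mk (?_ : (p.sum q).map φ = (p.map φ).sum (q.map φ))
    have h : ((Matrix.fromBlocks p.mat 0 0 q.mat).submatrix finSumFinEquiv.symm
        finSumFinEquiv.symm).map φ = (Matrix.fromBlocks (p.mat.map φ) 0 0 (q.mat.map φ)).submatrix
        finSumFinEquiv.symm finSumFinEquiv.symm := by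
      rw [← Matrix.submatrix_map, Matrix.fromBlocks_map]
      simp [Matrix.map_zero]
    simp only [MatProj.map, MatProj.sum, h]
    rfl

/-- For a unital algebra `A`, the Grothendieck group `K₀₀(A)` of `V(A)`. -/
abbrev K00 (A : Type*) [Ring A] [StarRing A] : Type _ := Algebra.GrothendieckAddGroup (VMon A)

/-- Functoriality of `K₀₀` for unital `*`-homomorphisms. -/
noncomputable def K00.map {A B : Type*} [Ring A] [StarRing A] [Algebra ℂ A]
    [Ring B] [StarRing B] [Algebra ℂ B] (φ : A →⋆ₐ[ℂ] B) : K00 A →+ K00 B :=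
  Algebra.GrothendieckAddGroup.lift (Algebra.GrothendieckAddGroup.of.comp (VMon.map φ))

theorem K00.map_of {A B : Type*} [Ring A] [StarRing A] [Algebra ℂ A]
    [Ring B] [StarRing B] [Algebra ℂ B] (φ : A →⋆ₐ[ℂ] B) (x : VMon A) :
    K00.map φ (Algebra.GrothendieckAddGroup.of x) =
      Algebra.GrothendieckAddGroup.of (VMon.map φ x) :=
  DFunLike.congr_fun (Algebra.GrothendieckAddGroup.lift.left_inv
    (Algebra.GrothendieckAddGroup.of.comp (VMon.map φ))) x

theorem K00.map_comp {A B C : Type*} [Ring A] [StarRing A] [Algebra ℂ A]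
    [Ring B] [StarRing B] [Algebra ℂ B] [Ring C] [StarRing C] [Algebra ℂ C]
    (ψ : B →⋆ₐ[ℂ] C) (φ : A →⋆ₐ[ℂ] B) (x : K00 A) :
    K00.map ψ (K00.map φ x) = K00.map (ψ.comp φ) x := by
  have h : (K00.map ψ).comp (K00.map φ) = K00.map (ψ.comp φ) := by
    apply Algebra.GrothendieckAddGroup.lift.symm.injective
    ext y
    change K00.map ψ (K00.map φ (Algebra.GrothendieckAddGroup.of y)) =
      K00.map (ψ.comp φ) (Algebra.GrothendieckAddGroup.of y)
    rw [K00.map_of, K00.map_of, K00.map_of]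
    obtain ⟨p⟩ := y
    rfl
  exact DFunLike.congr_fun h x

/-- The `*`-homomorphism `A~ → ℂ` from the unitization with kernel `A`. -/
def augmentation (A : Type*) [NonUnitalRing A] [StarRing A] [Module ℂ A] [IsScalarTower ℂ A A]
    [SMulCommClass ℂ A A] [StarModule ℂ A] : Unitization ℂ A →⋆ₐ[ℂ] ℂ :=
  { Unitization.fstHom ℂ A with map_star' := fun _ => rfl }

/-- The group `K₀(A)` of a not necessarily unital `C*`-algebra:
the kernel of `K₀₀(A~) → K₀₀(ℂ)`. -/
def K0 (A : Type*) [NonUnitalRing A] [StarRing A] [Module ℂ A] [IsScalarTower ℂ A A]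
    [SMulCommClass ℂ A A] [StarModule ℂ A] : Type _ :=
  (K00.map (augmentation A)).ker

noncomputable instance K0.instAddCommGroup (A : Type*) [NonUnitalRing A] [StarRing A] [Module ℂ A]
    [IsScalarTower ℂ A A] [SMulCommClass ℂ A A] [StarModule ℂ A] : AddCommGroup (K0 A) :=
  inferInstanceAs (AddCommGroup (K00.map (augmentation A)).ker)

theorem augmentation_comp {A B : Type*}
    [NonUnitalRing A] [StarRing A] [Module ℂ A] [IsScalarTower ℂ A A] [SMulCommClass ℂ A A]
    [StarModule ℂ A] [NonUnitalRing B] [StarRing B] [Module ℂ B] [IsScalarTower ℂ B B]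
    [SMulCommClass ℂ B B] [StarModule ℂ B] (φ : A →⋆ₙₐ[ℂ] B) :
    (augmentation B).comp (Unitization.starMap φ) = augmentation A := by
  ext a
  change (Unitization.starMap φ (Unitization.inr a)).fst = (Unitization.inr a : Unitization ℂ A).fst
  simp

/-- The homomorphism `φ_* : K₀(A) → K₀(B)` induced by a `*`-homomorphism `φ : A → B`. -/
noncomputable def K0.map {A B : Type*}
    [NonUnitalRing A] [StarRing A] [Module ℂ A] [IsScalarTower ℂ A A] [SMulCommClass ℂ A A]
    [StarModule ℂ A] [NonUnitalRing B] [StarRing B] [Module ℂ B] [IsScalarTower ℂ B B]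
    [SMulCommClass ℂ B B] [StarModule ℂ B] (φ : A →⋆ₙₐ[ℂ] B) : K0 A →+ K0 B :=
  ((K00.map (Unitization.starMap φ)).comp (K00.map (augmentation A)).ker.subtype).codRestrict
    (K00.map (augmentation B)).ker (fun x => by
    have hx : K00.map (augmentation A) x = 0 := x.2
    change K00.map (augmentation B) (K00.map (Unitization.starMap φ) x) = 0
    rw [K00.map_comp, augmentation_comp, hx])

/-- A projection of `A`, seen as a `1 × 1` matrix over the unitization `A~`. -/
def MatProj.ofProj {A : Type*} [NonUnitalRing A] [StarRing A] [Module ℂ A] [IsScalarTower ℂ A A]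
    [SMulCommClass ℂ A A] [StarModule ℂ A] (p : A) (hp : IsStarProjection p) :
    MatProj (Unitization ℂ A) where
  size := 1
  mat := Matrix.of fun _ _ => (p : Unitization ℂ A)
  isProj := by
    have h1 : star p = p := hp.isSelfAdjoint
    have h2 : p * p = p := hp.isIdempotentElem
    constructor
    · refine Matrix.ext fun i j => ?_
      rw [Matrix.mul_apply]
      simp [← Unitization.inr_mul, h2]
    · refine Matrix.ext fun i j => ?_
      rw [Matrix.star_apply]
      simp [← Unitization.inr_star, h1]

/-- The class `[p] ∈ K₀(A)` of a projection `p ∈ A`. -/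
noncomputable def K0.cls {A : Type*} [NonUnitalRing A] [StarRing A] [Module ℂ A]
    [IsScalarTower ℂ A A] [SMulCommClass ℂ A A] [StarModule ℂ A] (p : A)
    (hp : IsStarProjection p) : K0 A :=
  ⟨Algebra.GrothendieckAddGroup.of (VMon.mk (MatProj.ofProj p hp)), by
    change K00.map (augmentation A) _ = 0
    rw [K00.map_of]
    have h : VMon.map (augmentation A) (VMon.mk (MatProj.ofProj p hp)) = 0 := by
      have h0 : ((MatProj.ofProj p hp).map (augmentation A)).mat = 0 := by
        ext i j
        rfl
      refine VMon.sound (p := (MatProj.ofProj p hp).map (augmentation A))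
        (q := MatProj.zero ℂ) ⟨0, ?_, ?_⟩
      · rw [h0, Matrix.mul_zero]
      · ext i
        exact Fin.elim0 i
    rw [h, map_zero]⟩

end KTheory

section Geometry

/-- Uniform discreteness: distinct points have distance at least some `ε > 0`. -/
class UniformlyDiscrete (D : Type*) [MetricSpace D] : Prop where
  exists_le_dist : ∃ ε : ℝ, 0 < ε ∧ ∀ x y : D, x ≠ y → ε ≤ dist x y

instance UniformlyDiscrete.discreteTopology (D : Type*) [MetricSpace D] [UniformlyDiscrete D] :
    DiscreteTopology D := by
  obtain ⟨ε, hε, h⟩ := UniformlyDiscrete.exists_le_dist (D := D)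
  exact DiscreteTopology.of_forall_le_dist hε fun x y hxy => h x y hxy

/-- Bounded geometry of a discrete space: for every `R > 0` the number of points in the balls of
radius `R` is uniformly bounded. -/
def BoundedGeometry (D : Type*) [MetricSpace D] : Prop :=
  ∀ R : ℝ, 0 < R → ∃ N : ℕ, ∀ x : D, (Metric.closedBall x R).encard ≤ N

/-- The graph `D(α)`: the vertices are the points of `D`, and two distinct points are adjacent
if and only if their distance is at most `α`. -/
def ripsGraph (D : Type*) [MetricSpace D] (α : ℝ) : SimpleGraph D where
  Adj x y := x ≠ y ∧ dist x y ≤ α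
  symm := ⟨fun x y h => ⟨h.1.symm, by rw [dist_comm]; exact h.2⟩⟩
  loopless := ⟨fun _ h => h.1 rfl⟩

/-- For some `α > 0`, the graph `D(α)` has no finite connected components. -/
def NoFiniteComponents (D : Type*) [MetricSpace D] : Prop :=
  ∃ α : ℝ, 0 < α ∧ ∀ c : (ripsGraph D α).ConnectedComponent, ¬ c.supp.Finite

universe u v

/-- A ray structure on `D`: a partition of `D` into subsets `S i` together with uniformly
Lipschitz bijections `β i : ℕ → S i`. -/
def HasRayStructure (D : Type v) [MetricSpace D] : Prop :=
  ∃ (I : Type v) (S : I → Set D) (β : I → ℕ → D),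
    (⋃ i, S i) = Set.univ ∧ Pairwise (fun i j => Disjoint (S i) (S j)) ∧
    (∀ i, Set.BijOn (β i) Set.univ (S i)) ∧ ∃ L : NNReal, ∀ i, LipschitzWith L (β i)

/-- `D` embeds isometrically and coarsely densely into a discrete proper metric space
with a ray structure. -/
def EmbedsInRaySpace (D : Type u) [MetricSpace D] : Prop :=
  ∃ (D' : Type v) (_ : MetricSpace D'), DiscreteTopology D' ∧ ProperSpace D' ∧
    HasRayStructure D' ∧ ∃ j : D → D', Isometry j ∧
      ∃ C : ℝ, 0 < C ∧ ∀ x : D', ∃ y : D, dist x (j y) < C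

end Geometry

section Roe

open scoped ZeroAtInfty ComplexInnerProductSpace

/-- The Hilbert space `ℓ²(D) ⊗ H`, realized as the space `ℓ²(D; H)` of square summable
functions `D → H`. -/
abbrev L2 (D : Type*) (H : Type*) [NormedAddCommGroup H] : Type _ := lp (fun _ : D => H) 2

/-- The operator of multiplication by `f ∈ C₀(D)` on `ℓ²(D; H)`. -/
noncomputable def mulOp {D : Type*} [MetricSpace D] {H : Type*} [NormedAddCommGroup H]
    [InnerProductSpace ℂ H] (f : C₀(D, ℂ)) : L2 D H →L[ℂ] L2 D H :=
  lp.mapCLM 2 (fun x => f x • ContinuousLinearMap.id ℂ H) (norm_nonneg f.toBCF) (fun x =>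
    (norm_smul_le _ _).trans ((mul_le_of_le_one_right (norm_nonneg _)
      ContinuousLinearMap.norm_id_le).trans (f.toBCF.norm_coe_le_norm x)))

@[simp]
theorem mulOp_apply {D : Type*} [MetricSpace D] {H : Type*} [NormedAddCommGroup H]
    [InnerProductSpace ℂ H] (f : C₀(D, ℂ)) (ξ : L2 D H) (x : D) :
    mulOp f ξ x = f x • ξ x := rfl

/-- `T` is locally compact: `T f` and `f T` are compact for every `f ∈ C₀(D)`. -/
def IsLocallyCompactOp {D : Type*} [MetricSpace D] {H : Type*} [NormedAddCommGroup H]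
    [InnerProductSpace ℂ H] (T : L2 D H →L[ℂ] L2 D H) : Prop :=
  ∀ f : C₀(D, ℂ), IsCompactOperator (T * mulOp f : L2 D H →L[ℂ] L2 D H) ∧
    IsCompactOperator (mulOp f * T : L2 D H →L[ℂ] L2 D H)

/-- `T` has finite propagation: for some `R > 0`, `f T g = 0` for all `f, g ∈ C₀(D)` whose supports
are at distance greater than `R`. -/
def HasFinitePropagation {D : Type*} [MetricSpace D] {H : Type*} [NormedAddCommGroup H]
    [InnerProductSpace ℂ H] (T : L2 D H →L[ℂ] L2 D H) : Prop :=
  ∃ R : ℝ, 0 < R ∧ ∀ f g : C₀(D, ℂ),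
    (∀ x ∈ tsupport f, ∀ y ∈ tsupport g, R < dist x y) → mulOp f * T * mulOp g = 0

theorem mulOp_adjoint {D : Type*} [MetricSpace D] {H : Type*} [NormedAddCommGroup H]
    [InnerProductSpace ℂ H] [CompleteSpace H] (f : C₀(D, ℂ)) :
    star (mulOp f : L2 D H →L[ℂ] L2 D H) = mulOp (star f) := by
  rw [ContinuousLinearMap.star_eq_adjoint, eq_comm, ContinuousLinearMap.eq_adjoint_iff]
  intro ξ η
  rw [lp.inner_eq_tsum, lp.inner_eq_tsum]
  refine tsum_congr fun x => ?_
  simp [inner_smul_left, inner_smul_right]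

/-- The adjoint of a compact operator between Hilbert spaces is compact. -/
theorem isCompactOperator_adjoint {E F : Type*} [NormedAddCommGroup E] [InnerProductSpace ℂ E]
    [CompleteSpace E] [NormedAddCommGroup F] [InnerProductSpace ℂ F] [CompleteSpace F]
    {T : E →L[ℂ] F} (hT : IsCompactOperator T) :
    IsCompactOperator (ContinuousLinearMap.adjoint T) := by
  set S := ContinuousLinearMap.adjoint T with hS
  have hTS : IsCompactOperator (T ∘L S) := hT.comp_clm S
  have h1 : TotallyBounded ((T ∘L S) '' Metric.closedBall 0 1) :=
    (hTS.isCompact_closure_image_closedBall (f := ((T ∘L S : F →L[ℂ] F) : F →ₗ[ℂ] F))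
      1).totallyBounded.subset subset_closure
  have h2 : TotallyBounded (S '' Metric.closedBall 0 1) := by
    rw [Metric.totallyBounded_iff]
    intro ε hε
    obtain ⟨t, hts, htf, hcov⟩ := Metric.finite_approx_of_totallyBounded h1 (ε ^ 2 / 2) (by positivity)
    obtain ⟨t0, ht0, ht0f, rfl⟩ := Set.exists_subset_image_finite_and.1 ⟨t, hts, htf, rfl⟩
    refine ⟨S '' t0, ht0f.image _, ?_⟩
    rintro _ ⟨x, hx, rfl⟩
    obtain ⟨y, hy, hxy⟩ : ∃ y ∈ t0, ‖T (S (x - y))‖ < ε ^ 2 / 2 := by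
      have := hcov ⟨x, hx, rfl⟩
      simp only [Set.mem_iUnion, Set.mem_image, Metric.mem_ball] at this
      obtain ⟨_, ⟨y, hy, rfl⟩, h⟩ := this
      refine ⟨y, hy, ?_⟩
      rw [map_sub, map_sub, ← dist_eq_norm]
      exact h
    simp only [Set.mem_iUnion, Set.mem_image, Metric.mem_ball]
    refine ⟨S y, ⟨y, hy, rfl⟩, ?_⟩
    have hy1 := ht0 hy
    rw [mem_closedBall_zero_iff] at hx hy1
    have hn : ‖x - y‖ ≤ 2 := (norm_sub_le x y).trans (by linarith)
    have h3 : ‖S (x - y)‖ ^ 2 ≤ ‖T (S (x - y))‖ * 2 := by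
      have h4 : ⟪S (x - y), S (x - y)⟫ = ⟪T (S (x - y)), x - y⟫ :=
        ContinuousLinearMap.adjoint_inner_right T _ _
      have h5 : ‖S (x - y)‖ ^ 2 = ‖⟪S (x - y), S (x - y)⟫‖ := by
        rw [inner_self_eq_norm_sq_to_K]
        simp
      rw [h5, h4]
      exact (norm_inner_le_norm _ _).trans (by gcongr)
    rw [dist_eq_norm, ← map_sub]
    nlinarith [norm_nonneg (S (x - y))]
  refine (isCompactOperator_iff_isCompact_closure_image_closedBall
    (S : F →ₗ[ℂ] E) one_pos).2 ?_
  exact isCompact_iff_totallyBounded_isComplete.2 ⟨h2.closure, isClosed_closure.isComplete⟩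

section

variable {D : Type*} [MetricSpace D] [DiscreteTopology D]

/-- The indicator function of a point, as an element of `C₀(D)`. -/
noncomputable def pointFun (x : D) : C₀(D, ℂ) where
  toFun := Set.indicator {x} 1
  continuous_toFun := continuous_of_discreteTopology
  zero_at_infty' := by
    refine tendsto_const_nhds.congr' ?_
    filter_upwards [(isCompact_singleton (x := x)).compl_mem_cocompact] with y hy
    exact (Set.indicator_of_notMem hy _).symm

end

theorem finitePropagation_iff {D : Type*} [MetricSpace D] [DiscreteTopology D] {H : Type*}
    [NormedAddCommGroup H] [InnerProductSpace ℂ H] (T : L2 D H →L[ℂ] L2 D H) :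
    HasFinitePropagation T ↔ ∃ R : ℝ, 0 < R ∧ ∀ (ξ : L2 D H) (x : D),
      (∀ y, dist x y ≤ R → ξ y = 0) → T ξ x = 0 := by
  classical
  constructor
  · rintro ⟨R, hR, h⟩
    refine ⟨R, hR, fun ξ x hξ => ?_⟩
    have key : ∀ y, T (lp.single 2 y (ξ y)) x = 0 := by
      intro y
      by_cases hxy : dist x y ≤ R
      · rw [hξ y hxy, lp.single_zero, map_zero]
        rfl
      · have h1 := h (pointFun x) (pointFun y) (by
          intro a ha b hb
          have ha' : a = x := by
            rw [tsupport, closure_discrete] at ha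
            by_contra hne
            exact ha (Set.indicator_of_notMem (s := {x}) hne 1)
          have hb' : b = y := by
            rw [tsupport, closure_discrete] at hb
            by_contra hne
            exact hb (Set.indicator_of_notMem (s := {y}) hne 1)
          rw [ha', hb']
          exact not_le.1 hxy)
        have h2 : mulOp (pointFun y) (lp.single 2 y (ξ y) : L2 D H) = lp.single 2 y (ξ y) := by
          ext z
          rw [mulOp_apply]
          by_cases hz : z = y
          · subst hz
            simp [pointFun]
          · rw [lp.single_apply_ne _ _ _ hz, smul_zero]
        have h3 := congrArg (fun S : L2 D H →L[ℂ] L2 D H => S (lp.single 2 y (ξ y)) x) h1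
        simp only [mul_apply_eq_comp, h2, mulOp_apply] at h3
        simpa [pointFun] using h3
    have hs := (lp.hasSum_single (by simp) ξ).mapL (lp.evalCLM ℂ (fun _ : D => H) 2 x ∘L T)
    exact (hs.unique (by
      convert hasSum_zero with y
      exact key y))
  · rintro ⟨R, hR, h⟩
    refine ⟨R, hR, fun f g hfg => ?_⟩
    ext ξ x
    simp only [mul_apply_eq_comp, mulOp_apply]
    by_cases hx : f x = 0
    · rw [hx, zero_smul]
      rfl
    · rw [h _ x, smul_zero]
      · rfl
      · intro y hy
        rw [mulOp_apply]
        by_cases hgy : g y = 0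
        · rw [hgy, zero_smul]
        · exact absurd (hfg x (subset_tsupport _ hx) y (subset_tsupport _ hgy)) (not_lt.2 hy)

theorem HasFinitePropagation.star {D : Type*} [MetricSpace D] {H : Type*}
    [NormedAddCommGroup H] [InnerProductSpace ℂ H] [CompleteSpace H] {T : L2 D H →L[ℂ] L2 D H}
    (hT : HasFinitePropagation T) : HasFinitePropagation (star T) := by
  obtain ⟨R, hR, h⟩ := hT
  have hsupp : ∀ f : C₀(D, ℂ), tsupport (Star.star f : C₀(D, ℂ)) = tsupport f := by
    intro f
    rw [tsupport, tsupport]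
    congr 1
    ext x
    simp
  refine ⟨R, hR, fun f g hfg => ?_⟩
  have h1 := h (Star.star g) (Star.star f) (by
    intro x hx y hy
    rw [hsupp] at hx hy
    rw [dist_comm]
    exact hfg y hy x hx)
  have h2 := congrArg Star.star h1
  rw [star_mul, star_mul, mulOp_adjoint, mulOp_adjoint, star_star, star_star, star_zero,
    ← mul_assoc] at h2
  exact h2

theorem IsLocallyCompactOp.star {D : Type*} [MetricSpace D] {H : Type*}
    [NormedAddCommGroup H] [InnerProductSpace ℂ H] [CompleteSpace H] {T : L2 D H →L[ℂ] L2 D H}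
    (hT : IsLocallyCompactOp T) : IsLocallyCompactOp (star T) := by
  intro f
  have h := hT (Star.star f)
  have e1 : Star.star T * mulOp f = Star.star (mulOp (Star.star f) * T) := by
    rw [star_mul, mulOp_adjoint, star_star]
  have e2 : mulOp f * Star.star T = Star.star (T * mulOp (Star.star f)) := by
    rw [star_mul, mulOp_adjoint, star_star]
  rw [e1, e2]
  exact ⟨isCompactOperator_adjoint h.2, isCompactOperator_adjoint h.1⟩

/-- The `*`-algebra of locally compact operators of finite propagation on `ℓ²(D; H)`. -/
noncomputable def algebraicRoe (D : Type*) [MetricSpace D] [DiscreteTopology D] (H : Type*)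
    [NormedAddCommGroup H] [InnerProductSpace ℂ H] [CompleteSpace H] :
    NonUnitalStarSubalgebra ℂ (L2 D H →L[ℂ] L2 D H) where
  carrier := {T | IsLocallyCompactOp T ∧ HasFinitePropagation T}
  zero_mem' := by
    refine ⟨fun f => ?_, 1, one_pos, fun f g _ => by simp⟩
    rw [zero_mul, mul_zero]
    exact ⟨isCompactOperator_zero, isCompactOperator_zero⟩
  add_mem' := by
    rintro S T ⟨hS, hS'⟩ ⟨hT, hT'⟩
    refine ⟨fun f => ?_, ?_⟩
    · rw [add_mul, mul_add]
      exact ⟨(hS f).1.add (hT f).1, (hS f).2.add (hT f).2⟩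
    · obtain ⟨R, hR, h⟩ := hS'
      obtain ⟨R', hR', h'⟩ := hT'
      refine ⟨max R R', lt_max_of_lt_left hR, fun f g hfg => ?_⟩
      rw [mul_add, add_mul, h f g fun x hx y hy => (le_max_left _ _).trans_lt (hfg x hx y hy),
        h' f g fun x hx y hy => (le_max_right _ _).trans_lt (hfg x hx y hy), add_zero]
  smul_mem' := by
    rintro c T ⟨hT, hT'⟩
    refine ⟨fun f => ?_, ?_⟩
    · rw [smul_mul_assoc, mul_smul_comm]
      exact ⟨(hT f).1.smul c, (hT f).2.smul c⟩
    · obtain ⟨R, hR, h⟩ := hT'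
      refine ⟨R, hR, fun f g hfg => ?_⟩
      rw [mul_smul_comm, smul_mul_assoc, h f g hfg, smul_zero]
  mul_mem' := by
    rintro S T ⟨hS, hS'⟩ ⟨hT, hT'⟩
    refine ⟨fun f => ?_, ?_⟩
    · rw [mul_assoc, ← mul_assoc (mulOp f)]
      exact ⟨(hT f).1.clm_comp S, (hS f).2.comp_clm T⟩
    · rw [finitePropagation_iff] at hS' hT' ⊢
      obtain ⟨R, hR, h⟩ := hS'
      obtain ⟨R', hR', h'⟩ := hT'
      refine ⟨R + R', add_pos hR hR', fun ξ x hξ => ?_⟩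
      refine h (T ξ) x fun y hy => h' ξ y fun z hz => hξ z ?_
      exact (dist_triangle x y z).trans (add_le_add hy hz)
  star_mem' := fun h => ⟨h.1.star, h.2.star⟩

/-- The Roe algebra `C*_H(D)`: the norm closure in the bounded operators on `ℓ²(D) ⊗ H` of the
locally compact operators of finite propagation. For `H = ℂ` this is the uniform Roe algebra. -/
noncomputable def roeAlgebra (D : Type*) [MetricSpace D] [DiscreteTopology D] (H : Type*)
    [NormedAddCommGroup H] [InnerProductSpace ℂ H] [CompleteSpace H] :
    NonUnitalStarSubalgebra ℂ (L2 D H →L[ℂ] L2 D H) :=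
  (algebraicRoe D H).topologicalClosure

theorem opNorm_le_of_pointwise {D : Type*} {c : ℝ} (hc : 0 ≤ c) (A : L2 D ℂ →L[ℂ] L2 D ℂ)
    (hA : ∀ (ξ : L2 D ℂ) (x : D), ‖A ξ x‖ ≤ c * ‖ξ x‖) : ‖A‖ ≤ c := by
  refine A.opNorm_le_bound hc fun ξ => ?_
  refine lp.norm_le_of_forall_sum_le (by simp) (by positivity) fun s => ?_
  calc ∑ i ∈ s, ‖A ξ i‖ ^ (2 : ENNReal).toReal
      ≤ ∑ i ∈ s, c ^ (2 : ENNReal).toReal * ‖ξ i‖ ^ (2 : ENNReal).toReal := by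
        refine Finset.sum_le_sum fun i _ => ?_
        rw [← Real.mul_rpow hc (norm_nonneg _)]
        exact Real.rpow_le_rpow (norm_nonneg _) (hA ξ i) (by simp)
    _ ≤ (c * ‖ξ‖) ^ (2 : ENNReal).toReal := by
        rw [← Finset.mul_sum, Real.mul_rpow hc (norm_nonneg _)]
        gcongr
        exact lp.sum_rpow_le_norm_rpow (by simp) ξ s

theorem isCompactOperator_mulOp {D : Type*} [MetricSpace D] [DiscreteTopology D] (f : C₀(D, ℂ)) :
    IsCompactOperator (mulOp f : L2 D ℂ →L[ℂ] L2 D ℂ) := by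
  classical
  have hcl := isClosed_setOfPred_isCompactOperator (𝕜₁ := ℂ) (𝕜₂ := ℂ) (σ₁₂ := RingHom.id ℂ)
    (M₁ := L2 D ℂ) (M₂ := L2 D ℂ)
  refine hcl.closure_subset (Metric.mem_closure_iff.2 fun ε hε => ?_)
  have hfin : {x | ε / 2 ≤ ‖f x‖}.Finite := by
    have h := (zero_at_infty f).eventually (Metric.ball_mem_nhds 0 (half_pos hε))
    rw [Filter.Eventually, Filter.mem_cocompact] at h
    obtain ⟨K, hK, hKs⟩ := h
    refine hK.finite_of_discrete.subset fun x hx => ?_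
    by_contra hxK
    have := hKs hxK
    simp only [dist_zero_right, Set.mem_ofPred_eq] at this hx
    linarith
  let P : D → (L2 D ℂ →L[ℂ] L2 D ℂ) := fun x =>
    lp.singleContinuousLinearMap ℂ (fun _ : D => ℂ) 2 x ∘L lp.evalCLM ℂ (fun _ : D => ℂ) 2 x
  have hP : ∀ x, IsCompactOperator (P x) := fun x =>
    (isCompactOperator_of_locallyCompactSpace_rng
      (lp.singleContinuousLinearMap ℂ (fun _ : D => ℂ) 2 x)).comp_clm
      (lp.evalCLM ℂ (fun _ : D => ℂ) 2 x)
  refine ⟨∑ x ∈ hfin.toFinset, f x • P x, ?_, ?_⟩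
  · exact Submodule.sum_mem (compactOperator (RingHom.id ℂ) (L2 D ℂ) (L2 D ℂ))
      fun x _ => Submodule.smul_mem _ _ (hP x)
  · rw [dist_eq_norm]
    refine (opNorm_le_of_pointwise (half_pos hε).le _ fun ξ x => ?_).trans_lt (half_lt_self hε)
    have hval : (∑ y ∈ hfin.toFinset, f y • P y) ξ x =
        if x ∈ hfin.toFinset then f x • ξ x else 0 := by
      rw [sum_apply, lp.coeFn_sum, Finset.sum_apply]
      have : ∀ y, ((f y • P y) ξ) x = if x = y then f x • ξ x else 0 := by
        intro y
        change f y • (lp.single 2 y (ξ y) : L2 D ℂ) x = _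
        split_ifs with hxy
        · subst hxy
          simp
        · rw [lp.single_apply_ne _ _ _ hxy, smul_zero]
      rw [Finset.sum_congr rfl fun y _ => this y, Finset.sum_ite_eq]
    change ‖mulOp f ξ x - (∑ y ∈ hfin.toFinset, f y • P y) ξ x‖ ≤ _
    rw [hval, mulOp_apply]
    split_ifs with hx
    · simp only [sub_self, norm_zero]
      positivity
    · rw [sub_zero, norm_smul]
      have : ‖f x‖ < ε / 2 := by simpa using hx
      gcongr

/-- The unit `1` of the uniform Roe algebra `C*_ℂ(D)`: the identity operator of `ℓ²(D)`. -/
noncomputable def roeUnit (D : Type*) [MetricSpace D] [DiscreteTopology D] : roeAlgebra D ℂ :=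
  ⟨1, NonUnitalStarSubalgebra.le_topologicalClosure _ ⟨fun f => by
      rw [one_mul, mul_one]
      exact ⟨isCompactOperator_mulOp f, isCompactOperator_mulOp f⟩,
    (finitePropagation_iff _).2 ⟨1, one_pos, fun ξ x h => h x (by simp)⟩⟩⟩

theorem isStarProjection_roeUnit (D : Type*) [MetricSpace D] [DiscreteTopology D] :
    IsStarProjection (roeUnit D) :=
  ⟨Subtype.ext (one_mul (1 : L2 D ℂ →L[ℂ] L2 D ℂ)),
    Subtype.ext (star_one (L2 D ℂ →L[ℂ] L2 D ℂ))⟩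

/-- The isometry `V_D = id ⊗ V : ℓ²(D) → ℓ²(D) ⊗ H` for an isometry `V : ℂ → H`. -/
noncomputable def ampl (D : Type*) {H : Type*} [NormedAddCommGroup H] [InnerProductSpace ℂ H]
    (V : ℂ →ₗᵢ[ℂ] H) : L2 D ℂ →L[ℂ] L2 D H :=
  lp.mapCLM 2 (fun _ => V.toContinuousLinearMap) zero_le_one
    (fun _ => V.norm_toContinuousLinearMap_le)

@[simp]
theorem ampl_apply {D : Type*} {H : Type*} [NormedAddCommGroup H] [InnerProductSpace ℂ H]
    (V : ℂ →ₗᵢ[ℂ] H) (ξ : L2 D ℂ) (x : D) : ampl D V ξ x = V (ξ x) := rfl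

theorem ampl_adjoint_comp {D : Type*} {H : Type*} [NormedAddCommGroup H] [InnerProductSpace ℂ H]
    [CompleteSpace H] (V : ℂ →ₗᵢ[ℂ] H) :
    ContinuousLinearMap.adjoint (ampl D V) ∘L ampl D V = 1 := by
  refine ContinuousLinearMap.ext fun ξ => ext_inner_left ℂ fun η => ?_
  rw [ContinuousLinearMap.comp_apply, ContinuousLinearMap.adjoint_inner_right,
    lp.inner_eq_tsum, one_apply_eq_self, lp.inner_eq_tsum]
  exact tsum_congr fun x => V.inner_map_map _ _

theorem mulOp_ampl {D : Type*} [MetricSpace D] {H : Type*} [NormedAddCommGroup H]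
    [InnerProductSpace ℂ H] (V : ℂ →ₗᵢ[ℂ] H) (f : C₀(D, ℂ)) :
    mulOp f ∘L ampl D V = ampl D V ∘L mulOp f := by
  ext ξ x
  exact ((V.map_smul (f x) (ξ x)).symm :)

theorem ampl_adjoint_mulOp {D : Type*} [MetricSpace D] {H : Type*} [NormedAddCommGroup H]
    [InnerProductSpace ℂ H] [CompleteSpace H] (V : ℂ →ₗᵢ[ℂ] H) (f : C₀(D, ℂ)) :
    ContinuousLinearMap.adjoint (ampl D V) ∘L mulOp f =
      mulOp f ∘L ContinuousLinearMap.adjoint (ampl D V) := by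
  have h := congrArg ContinuousLinearMap.adjoint (mulOp_ampl V (star f))
  rw [ContinuousLinearMap.adjoint_comp, ContinuousLinearMap.adjoint_comp,
    ← ContinuousLinearMap.star_eq_adjoint (mulOp (star f) : L2 D H →L[ℂ] L2 D H),
    ← ContinuousLinearMap.star_eq_adjoint (mulOp (star f) : L2 D ℂ →L[ℂ] L2 D ℂ),
    mulOp_adjoint, mulOp_adjoint, star_star] at h
  exact h

/-- The `*`-homomorphism `T ↦ V_D T V_D*` on all bounded operators. -/
noncomputable def conjAmpl (D : Type*) {H : Type*} [NormedAddCommGroup H] [InnerProductSpace ℂ H]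
    [CompleteSpace H] (V : ℂ →ₗᵢ[ℂ] H) :
    (L2 D ℂ →L[ℂ] L2 D ℂ) →⋆ₙₐ[ℂ] (L2 D H →L[ℂ] L2 D H) where
  toFun T := ampl D V ∘L T ∘L ContinuousLinearMap.adjoint (ampl D V)
  map_smul' c T := by simp
  map_zero' := by simp
  map_add' S T := by simp
  map_mul' S T := by
    have h := fun η : L2 D ℂ => DFunLike.congr_fun (ampl_adjoint_comp (D := D) V) η
    ext1 ξ
    simp only [mul_apply_eq_comp, ContinuousLinearMap.comp_apply,
      one_apply_eq_self] at h ⊢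
    rw [h]
  map_star' T := by
    simp [ContinuousLinearMap.star_eq_adjoint, ContinuousLinearMap.adjoint_comp,
      ContinuousLinearMap.comp_assoc]

theorem conjAmpl_mem {D : Type*} [MetricSpace D] [DiscreteTopology D] {H : Type*}
    [NormedAddCommGroup H] [InnerProductSpace ℂ H] [CompleteSpace H] (V : ℂ →ₗᵢ[ℂ] H)
    {T : L2 D ℂ →L[ℂ] L2 D ℂ} (hT : T ∈ roeAlgebra D ℂ) : conjAmpl D V T ∈ roeAlgebra D H := by
  have hcont : Continuous (conjAmpl D V) :=
    continuous_const.clm_comp (continuous_id.clm_comp continuous_const)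
  refine map_mem_closure hcont hT ?_
  rintro S ⟨hS, R, hR, h⟩
  have e1 : ∀ f : C₀(D, ℂ), conjAmpl D V S * mulOp f = conjAmpl D V (S * mulOp f) := by
    intro f
    change ampl D V ∘L S ∘L (ContinuousLinearMap.adjoint (ampl D V) ∘L mulOp f) = _
    rw [ampl_adjoint_mulOp]
    rfl
  have e2 : ∀ (f : C₀(D, ℂ)) (A : L2 D ℂ →L[ℂ] L2 D ℂ),
      mulOp f * conjAmpl D V A = conjAmpl D V (mulOp f * A) := by
    intro f A
    change (mulOp f ∘L ampl D V) ∘L A ∘L ContinuousLinearMap.adjoint (ampl D V) = _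
    rw [mulOp_ampl]
    rfl
  refine ⟨fun f => ?_, R, hR, fun f g hfg => ?_⟩
  · rw [e1, e2]
    exact ⟨((hS f).1.comp_clm _).clm_comp (ampl D V), ((hS f).2.comp_clm _).clm_comp (ampl D V)⟩
  · rw [mul_assoc, e1, e2, ← mul_assoc, h f g hfg, map_zero]

/-- The `*`-homomorphism `i_D : C*_ℂ(D) → C*_H(D)`, `T ↦ V_D T V_D*`. -/
noncomputable def roeInclusion (D : Type*) [MetricSpace D] [DiscreteTopology D] {H : Type*}
    [NormedAddCommGroup H] [InnerProductSpace ℂ H] [CompleteSpace H] (V : ℂ →ₗᵢ[ℂ] H) :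
    roeAlgebra D ℂ →⋆ₙₐ[ℂ] roeAlgebra D H :=
  NonUnitalStarAlgHom.codRestrict
    ((conjAmpl D V).comp (NonUnitalStarSubalgebraClass.subtype (roeAlgebra D ℂ)))
    (roeAlgebra D H) (fun T => conjAmpl_mem V T.2)

end Roe

end CoarseK

namespace CoarseK

/-! The argument is an Eilenberg swindle carried out inside `C*_H(D)`. The class to be killed is
that of `p = V_D V_D*`, the projection onto the closed span of the vectors `δ_x ⊗ V 1`. It suffices
to find a projection `q` orthogonal to `p` and a partial isometry `v`, both in the Roe algebra, with
`v* v = p + q` and `v v* = q`: then `[p] + [q] = [q]`, and `[p] = 0` by cancellation in the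
Grothendieck group (`K0.cls_eq_zero_of_absorbed`).

Such `q` and `v` come from the geometric property `HasEscape`: each `x` has a path `t x 0 = x, t x
1, t x 2, …` with steps of length at most `R`, and each point of `D` is visited only finitely often
by all the paths together. Since `H` is infinite-dimensional, there is room to choose labels making
the vectors `b (x, n) = δ_{t x n} ⊗ e_{lab (x, n)}` orthonormal with `b (x, 0) = δ_x ⊗ V 1`. Let `q`
project onto the span of the `b (x, n + 1)` and let `v` send `b (x, n)` to `b (x, n + 1)`. Bounded
steps give finite propagation, finite visits give local compactness (`transfer_mem_algebraicRoe`),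
and `roeUnit_cls_eq_zero` assembles the pieces.

Both geometric conditions imply `HasEscape`. With a ray structure on `D'`, points are pushed outward
along the rays and each position is replaced by a nearby point of `D`. If `D(α)` has no finite
components, each component has an infinite, finitely branching spanning tree. A vertex with
infinitely many descendants moves to a child of the same kind, which exists by König's lemma; every
other vertex moves to its parent. Iterating this map gives the paths
(`exists_finite_backward_orbits`). -/

/-! ### Absorbed projections in `K₀`. -/

theorem K0.map_cls {A B : Type*}
    [NonUnitalRing A] [StarRing A] [Module ℂ A] [IsScalarTower ℂ A A] [SMulCommClass ℂ A A]
    [StarModule ℂ A] [NonUnitalRing B] [StarRing B] [Module ℂ B] [IsScalarTower ℂ B B]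
    [SMulCommClass ℂ B B] [StarModule ℂ B] (φ : A →⋆ₙₐ[ℂ] B) (p : A) (hp : IsStarProjection p)
    (hφp : IsStarProjection (φ p)) : K0.map φ (K0.cls p hp) = K0.cls (φ p) hφp := by
  refine Subtype.ext ?_
  change K00.map (Unitization.starMap φ) (Algebra.GrothendieckAddGroup.of _) =
    Algebra.GrothendieckAddGroup.of _
  rw [K00.map_of]
  refine congrArg _ (VMon.sound (p := (MatProj.ofProj p hp).map (Unitization.starMap φ))
    (q := MatProj.ofProj (φ p) hφp) ?_)
  have h : ((MatProj.ofProj p hp).map (Unitization.starMap φ)).mat =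
      (MatProj.ofProj (φ p) hφp).mat := by
    refine Matrix.ext fun i j => ?_
    change Unitization.starMap φ (p : Unitization ℂ A) = ((φ p : B) : Unitization ℂ B)
    simp
  exact h ▸ MvN.refl (MatProj.isProj _)

theorem mvN_one_of_absorbed {B : Type*} [Ring B] [StarRing B] {p q v : B}
    (hp : IsStarProjection p) (hq : IsStarProjection q) (hpq : p * q = 0)
    (hv : star v * v = p + q) (hv' : v * star v = q) :
    MvN (Matrix.fromBlocks (Matrix.of fun _ _ : Fin 1 => p) 0 0 (Matrix.of fun _ _ : Fin 1 => q))
      (Matrix.of fun _ _ : Fin 1 => q) := by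
  have p1 : star p = p := hp.isSelfAdjoint
  have p2 : p * p = p := hp.isIdempotentElem
  have q1 : star q = q := hq.isSelfAdjoint
  have q2 : q * q = q := hq.isIdempotentElem
  have hqp : q * p = 0 := by simpa [p1, q1] using congrArg star hpq
  have key : ∀ a b : B, star a = a → star (v * a) * (v * b) = a * (p + q) * b := by
    intro a b ha
    rw [star_mul, ha, ← hv]
    simp only [mul_assoc]
  -- The witness is the row `(v p, v q)`. Its Gram matrix has entries `a (p + q) b` with `a, b ∈ {p,
  -- q}`, so orthogonality removes the off-diagonal ones.
  refine ⟨Matrix.of fun _ => Sum.elim (fun _ => v * p) (fun _ => v * q), ?_, ?_⟩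
  · refine Matrix.ext ?_
    rintro (i | i) (j | j) <;> rw [Matrix.mul_apply, Fintype.sum_unique] <;>
      simp only [Matrix.conjTranspose_apply, Matrix.of_apply, Sum.elim_inl, Sum.elim_inr,
        key _ _ p1, key _ _ q1, mul_add, p2, q2, hpq, hqp, Matrix.fromBlocks_apply₁₁,
        Matrix.fromBlocks_apply₁₂, Matrix.fromBlocks_apply₂₁, Matrix.fromBlocks_apply₂₂,
        add_zero, zero_add, Matrix.zero_apply]
  · refine Matrix.ext fun i j => ?_
    rw [Matrix.mul_apply, Fintype.sum_sum_type, Fintype.sum_unique, Fintype.sum_unique]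
    calc v * p * star (v * p) + v * q * star (v * q)
        = v * (p * p + q * q) * star v := by
          simp only [star_mul, p1, q1, mul_add, add_mul, mul_assoc]
      _ = (v * star v) * (v * star v) := by
          rw [p2, q2, ← hv]; simp only [mul_assoc]
      _ = q := by rw [hv', q2]

theorem isStarProjection_inr {A : Type*} [NonUnitalRing A] [StarRing A] [Module ℂ A]
    [IsScalarTower ℂ A A] [SMulCommClass ℂ A A] [StarModule ℂ A] {p : A}
    (hp : IsStarProjection p) : IsStarProjection (p : Unitization ℂ A) :=
  ⟨by rw [IsIdempotentElem, ← Unitization.inr_mul, hp.isIdempotentElem.eq],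
    by rw [IsSelfAdjoint, ← Unitization.inr_star, hp.isSelfAdjoint.star_eq]⟩

/-- A projection `p` has trivial class as soon as it is orthogonal to a projection `q` such that
`p + q` is Murray--von Neumann equivalent to `q`. -/
theorem K0.cls_eq_zero_of_absorbed {A : Type*} [NonUnitalRing A] [StarRing A] [Module ℂ A]
    [IsScalarTower ℂ A A] [SMulCommClass ℂ A A] [StarModule ℂ A] {p q v : A}
    (hp : IsStarProjection p) (hq : IsStarProjection q) (hpq : p * q = 0)
    (hv : star v * v = p + q) (hv' : v * star v = q) : K0.cls p hp = 0 := by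
  have hadd : VMon.mk (MatProj.ofProj p hp) + VMon.mk (MatProj.ofProj q hq) =
      VMon.mk (MatProj.ofProj q hq) := by
    refine VMon.sound (p := (MatProj.ofProj p hp).sum (MatProj.ofProj q hq))
      (q := MatProj.ofProj q hq) ?_
    refine MvN.trans (MatProj.isProj _) (MatProj.isProj _) (MatProj.sum_mvn _ _).symm ?_
    exact mvN_one_of_absorbed (v := (v : Unitization ℂ A)) (isStarProjection_inr hp)
      (isStarProjection_inr hq) (by rw [← Unitization.inr_mul, hpq, Unitization.inr_zero])
      (by rw [← Unitization.inr_star, ← Unitization.inr_mul, hv, Unitization.inr_add])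
      (by rw [← Unitization.inr_star, ← Unitization.inr_mul, hv'])
  refine Subtype.ext ?_
  change Algebra.GrothendieckAddGroup.of (VMon.mk (MatProj.ofProj p hp)) = 0
  have h := congrArg Algebra.GrothendieckAddGroup.of hadd
  rw [map_add] at h
  -- Cancellation is available only here, after passing from `V` to its Grothendieck group.
  exact add_eq_right.1 h

/-! ### Escaping to infinity: trees and rays. -/

/-- A forest, given by its depth and parent functions, with finite branching and infinite trees
carries a self-map moving every vertex to a neighbour, all of whose backward orbits are finite. -/
theorem exists_finite_backward_orbits {X : Type*} (depth : X → ℕ) (par : X → X)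
    (hpar : ∀ x, depth x ≠ 0 → depth (par x) + 1 = depth x)
    (hchild : ∀ y, {z | depth z = depth y + 1 ∧ par z = y}.Finite)
    (hinf : ∀ r, depth r = 0 → {x | par^[depth x] x = r}.Infinite) :
    ∃ f : X → X, (∀ x, (depth x ≠ 0 ∧ f x = par x) ∨ (depth (f x) ≠ 0 ∧ par (f x) = x)) ∧
      ∀ y, {z : X × ℕ | f^[z.2] z.1 = y}.Finite := by
  classical
  -- Descendants of `y`, paired with their generation. The depth condition excludes iterates that
  -- run past a root, where `par` is unconstrained.
  let desc : X → Set (X × ℕ) := fun y => {z | par^[z.2] z.1 = y ∧ depth z.1 = depth y + z.2}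
  have desc_finite : ∀ y, (∀ z, depth z = depth y + 1 → par z = y → (desc z).Finite) →
      (desc y).Finite := by
    intro y h
    -- A descendant of `y` is `y` itself or a descendant of one of its finitely many children.
    refine ((Set.finite_singleton (y, 0)).union ((hchild y).biUnion fun z hz =>
      (h z hz.1 hz.2).image fun w => (w.1, w.2 + 1))).subset ?_
    rintro ⟨x, n⟩ ⟨h1, h2⟩
    cases n with
    | zero => exact Or.inl (by simpa using h1)
    | succ n =>
      refine Or.inr (Set.mem_biUnion (x := par^[n] x) ?_ ⟨(x, n), ⟨rfl, ?_⟩, rfl⟩)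
      all_goals
        have hd : ∀ m, m ≤ depth x → depth (par^[m] x) + m = depth x := by
          intro m
          induction m with
          | zero => intro; rfl
          | succ m ih =>
            intro hm
            have h3 := ih (by omega)
            have h4 := hpar (par^[m] x) (by omega)
            rw [Function.iterate_succ_apply']
            omega
        simp only at h1 h2
        have h3 := hd n (by omega)
      · rw [Function.iterate_succ_apply'] at h1
        exact ⟨by omega, h1⟩
      · exact h3.symm
  have root_infinite : ∀ r, depth r = 0 → (desc r).Infinite := by
    intro r hr hf
    refine hinf r hr ((hf.image Prod.fst).subset fun x hx => ?_)
    exact ⟨(x, depth x), ⟨hx, by simp [hr]⟩, rfl⟩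
  -- König's lemma: some child inherits the infinitude of descendants.
  have hnext : ∀ y, (desc y).Infinite →
      ∃ z, depth z = depth y + 1 ∧ par z = y ∧ (desc z).Infinite := by
    intro y hy
    by_contra! h
    exact hy (desc_finite y fun z h1 h2 => h z h1 h2)
  choose! next hn1 hn2 hn3 using hnext
  let f : X → X := fun x => if (desc x).Infinite then next x else par x
  have hfi : ∀ x, (desc x).Infinite → f x = next x := fun x h => if_pos h
  have hff : ∀ x, ¬ (desc x).Infinite → f x = par x := fun x h => if_neg h
  have hff' : ∀ x, ¬ (desc x).Infinite → depth x ≠ 0 := fun x h h0 => h (root_infinite x h0)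
  refine ⟨f, fun x => ?_, ?_⟩
  · by_cases h : (desc x).Infinite
    · right
      rw [hfi x h]
      exact ⟨by rw [hn1 x h]; omega, hn2 x h⟩
    · exact Or.inl ⟨hff' x h, hff x h⟩
  let back : X → Set (X × ℕ) := fun y => {z | f^[z.2] z.1 = y}
  -- A vertex with infinitely many descendants is sent to another such vertex. Hence every vertex
  -- whose orbit ends at a `y` with finitely many descendants has moved only towards parents, so it
  -- is a descendant of `y`.
  have back_finite_of_desc : ∀ y, ¬ (desc y).Infinite → (back y).Finite := by
    intro y hy
    refine (Set.not_infinite.1 hy).subset ?_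
    suffices ∀ n x y, ¬ (desc y).Infinite → f^[n] x = y → (x, n) ∈ desc y from
      fun z hz => this z.2 z.1 y hy hz
    intro n
    induction n with
    | zero => intro x y _ h; exact ⟨h, by simp [show x = y from h]⟩
    | succ n ih =>
      intro x y hy h
      rw [Function.iterate_succ_apply'] at h
      have hw : ¬ (desc (f^[n] x)).Infinite := by
        intro hw
        rw [hfi _ hw] at h
        exact hy (h ▸ hn3 _ hw)
      obtain ⟨h1, h2⟩ := ih x _ hw rfl
      have h3 := hpar _ (hff' _ hw)
      rw [hff _ hw] at h
      simp only at h1 h2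
      refine ⟨?_, ?_⟩
      · simp only [Function.iterate_succ_apply', h1, h]
      · simp only
        rw [h] at h3
        omega
  -- The `f`-preimages of `y` are children with finitely many descendants, whose backward orbits are
  -- already known to be finite, and possibly the parent of `y`. This reduces the claim for `y` to
  -- its parent, and induction on depth finishes.
  have back_step : ∀ y, ((depth y ≠ 0) → (back (par y)).Finite) → (back y).Finite := by
    intro y h
    refine ((Set.finite_singleton (y, 0)).union (((hchild y).biUnion
      (t := fun z => if (desc z).Infinite then ∅ else back z) fun z _ => ?_).image
        (fun w => (w.1, w.2 + 1)) |>.union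
      ((Set.Finite.image (fun w => (w.1, w.2 + 1))
        (s := if depth y ≠ 0 then back (par y) else ∅) ?_)))).subset ?_
    · split_ifs with hz
      · exact Set.finite_empty
      · exact back_finite_of_desc z hz
    · split_ifs with hy
      · exact h hy
      · exact Set.finite_empty
    · rintro ⟨x, n⟩ hx
      cases n with
      | zero => exact Or.inl (by simpa [back] using hx)
      | succ n =>
        right
        change f^[n + 1] x = y at hx
        rw [Function.iterate_succ_apply'] at hx
        by_cases hw : (desc (f^[n] x)).Infinite
        · right
          refine ⟨(x, n), ?_, rfl⟩
          rw [hfi _ hw] at hx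
          have h1 := hn1 _ hw
          have h2 := hn2 _ hw
          rw [hx] at h1 h2
          rw [if_pos (by omega)]
          exact h2.symm
        · left
          refine ⟨(x, n), Set.mem_biUnion (x := f^[n] x) ?_ ?_, rfl⟩
          · rw [hff _ hw] at hx
            have h3 := hpar _ (hff' _ hw)
            rw [hx] at h3
            exact ⟨h3.symm, hx⟩
          · rw [if_neg hw]
            exact rfl
  suffices ∀ n y, depth y = n → (back y).Finite from fun y => this _ y rfl
  intro n
  induction n with
  | zero => exact fun y hy => back_step y fun h => absurd hy h
  | succ n ih => exact fun y hy => back_step y fun h => ih _ (by have := hpar y h; omega)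

/-- Every point of `D` can be moved to infinity in steps of bounded length, in a jointly locally
finite way. -/
def HasEscape (D : Type*) [MetricSpace D] : Prop :=
  ∃ (t : D → ℕ → D) (R : ℝ), (∀ x, t x 0 = x) ∧ (∀ x n, dist (t x n) (t x (n + 1)) ≤ R) ∧
    ∀ y, {z : D × ℕ | t z.1 z.2 = y}.Finite

/-- The neighbour is the next vertex on a geodesic from `v` back to `u`. It serves as the parent of
`v` in a spanning tree rooted at `u`. -/
theorem _root_.SimpleGraph.Reachable.exists_adj_dist_add_one_eq {V : Type*} {G : SimpleGraph V}
    {u v : V} (h : G.Reachable u v) (hne : G.dist u v ≠ 0) :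
    ∃ w, G.Adj v w ∧ G.dist u w + 1 = G.dist u v := by
  obtain ⟨p, hp⟩ := h.symm.exists_walk_length_eq_dist
  rw [G.dist_comm] at hp
  cases p with
  | nil => exact absurd hp.symm hne
  | cons hadj q =>
    rename_i w
    refine ⟨w, hadj, ?_⟩
    have h1 : G.dist u w ≤ q.length := by
      rw [G.dist_comm]; exact SimpleGraph.dist_le q
    have h2 : G.dist u v ≤ G.dist u w + 1 := by
      obtain ⟨r, hr⟩ := (h.trans hadj.reachable).exists_walk_length_eq_dist
      rw [← hr]
      simpa using SimpleGraph.dist_le (r.concat hadj.symm)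
    rw [SimpleGraph.Walk.length_cons] at hp
    omega

/-- Geodesic parents make each component of `D(α)` a rooted tree. It is infinite by hypothesis, and
bounded geometry makes it finitely branching because children lie within `α` of their parent. The
escape moves along tree edges, so `R = α`. -/
theorem NoFiniteComponents.hasEscape {D : Type*} [MetricSpace D] (hbg : BoundedGeometry D)
    (h : NoFiniteComponents D) : HasEscape D := by
  obtain ⟨α, hα, hinf⟩ := h
  set G := ripsGraph D α with hG
  let root : D → D := fun x => (G.connectedComponentMk x).out
  have hroot : ∀ x, G.Reachable (root x) x := fun x =>
    SimpleGraph.ConnectedComponent.exact (Quot.out_eq _)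
  have root_eq : ∀ {x y}, G.Reachable x y → root x = root y := fun h =>
    congrArg Quot.out (SimpleGraph.ConnectedComponent.sound h)
  let depth : D → ℕ := fun x => G.dist (root x) x
  have hex : ∀ x, depth x ≠ 0 → ∃ w, G.Adj x w ∧ depth w + 1 = depth x := by
    intro x hx
    obtain ⟨w, h1, h2⟩ := (hroot x).exists_adj_dist_add_one_eq hx
    refine ⟨w, h1, ?_⟩
    change G.dist (root w) w + 1 = _
    rwa [← root_eq h1.reachable]
  choose! par hadj hdep using hex
  have hiter : ∀ x, par^[depth x] x = root x := by
    suffices ∀ n x, depth x = n → par^[n] x = root x from fun x => this _ x rfl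
    intro n
    induction n with
    | zero => exact fun x hx => (((hroot x).dist_eq_zero_iff).1 hx).symm
    | succ n ih =>
      intro x hx
      rw [Function.iterate_succ_apply, ih _ (by have := hdep x (by omega); omega)]
      exact (root_eq (hadj x (by omega)).reachable).symm
  obtain ⟨f, hf1, hf2⟩ := exists_finite_backward_orbits depth par hdep
    (by
      intro y
      obtain ⟨N, hN⟩ := hbg α hα
      refine (Set.finite_of_encard_le_coe (hN y)).subset ?_
      rintro z ⟨hz, rfl⟩
      exact (hadj z (by omega)).2)
    (by
      intro r hr
      refine Set.Infinite.mono ?_ (hinf (G.connectedComponentMk r))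
      intro x hx
      rw [SimpleGraph.ConnectedComponent.mem_supp_iff, SimpleGraph.ConnectedComponent.eq] at hx
      change par^[depth x] x = r
      rw [hiter, root_eq hx]
      exact ((hroot r).dist_eq_zero_iff).1 hr)
  refine ⟨fun x n => f^[n] x, α, fun x => rfl, fun x n => ?_, hf2⟩
  simp only [Function.iterate_succ_apply']
  rcases hf1 (f^[n] x) with ⟨h1, h2⟩ | ⟨h1, h2⟩
  · rw [h2]
    exact (hadj _ h1).2
  · have := (hadj _ h1).2
    rwa [h2, dist_comm] at this

theorem EmbedsInRaySpace.hasEscape {D : Type*} [MetricSpace D] (h : EmbedsInRaySpace D) :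
    HasEscape D := by
  classical
  obtain ⟨D', _, hdisc, hprop, ⟨I, S, β, hcov, hdisj, hbij, L, hL⟩, j, hj, C, hC, hdense⟩ := h
  choose c hc using hdense
  have hmem : ∀ x, ∃ i n, β i n = x := by
    intro x
    obtain ⟨i, hi⟩ := Set.mem_iUnion.1 (hcov.symm ▸ Set.mem_univ x)
    obtain ⟨n, -, hn⟩ := (hbij i).surjOn hi
    exact ⟨i, n, hn⟩
  choose a m ham using hmem
  have hβ : ∀ {i n i' n'}, β i n = β i' n' → i = i' ∧ n = n' := by
    intro i n i' n' h
    have h1 : i = i' := by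
      by_contra hne
      exact Set.disjoint_left.1 (hdisj hne) ((hbij i).mapsTo (Set.mem_univ n))
        (h ▸ (hbij i').mapsTo (Set.mem_univ n'))
    subst h1
    exact ⟨rfl, (hbij i).injOn (Set.mem_univ _) (Set.mem_univ _) h⟩
  -- The outward shift along the ray of `j x`, starting at its position `m (j x)`.
  let s : D → ℕ → D' := fun x n => β (a (j x)) (m (j x) + n)
  have hs0 : ∀ x, s x 0 = j x := fun x => ham _
  have hsfin : ∀ y, {z : D × ℕ | s z.1 z.2 = y}.Finite := by
    intro y
    -- The point at position `m y` of its ray is reached after at most `m y` steps, and for a given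
    -- number of steps from only one starting point.
    refine Set.Finite.of_finite_image (f := Prod.snd) ((Set.finite_Iic (m y)).subset ?_) ?_
    · rintro _ ⟨⟨x, n⟩, hz, rfl⟩
      have := (hβ (hz.trans (ham y).symm)).2
      simp only [Set.mem_Iic]
      omega
    · rintro ⟨x, n⟩ hz ⟨x', n'⟩ hz' hn
      simp only at hn
      subst hn
      obtain ⟨h1, h2⟩ := hβ (Eq.trans hz (Eq.symm hz'))
      simp only at h1 h2
      refine Prod.ext (hj.injective ?_) rfl
      rw [← ham (j x), ← ham (j x'), h1, show m (j x) = m (j x') by omega]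
  have hcfin : ∀ y, {x | c x = y}.Finite := by
    intro y
    -- Properness makes the fibres of the approximation `c : D' → D` finite, so local finiteness
    -- descends from `D'` to `D`.
    refine ((isCompact_closedBall (j y) C).finite_of_discrete).subset ?_
    rintro x rfl
    exact (hc x).le
  -- Time `0` is treated separately because `c (j x)` need not be `x`. The bound allows for one
  -- approximation error `C` at each end of a ray step of length at most `L`.
  refine ⟨fun x n => if n = 0 then x else c (s x n), C + L + C, fun x => rfl, fun x n => ?_, ?_⟩
  · have hclose : ∀ n, dist (s x n) (j (if n = 0 then x else c (s x n))) ≤ C := by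
      intro n
      split_ifs with hn
      · rw [hn, hs0, dist_self]; exact hC.le
      · exact (hc _).le
    have hstep : dist (s x n) (s x (n + 1)) ≤ L := by
      refine ((hL _).dist_le_mul _ _).trans ?_
      simp [Nat.dist_eq]
    rw [← hj.dist_eq]
    refine (dist_triangle4 _ (s x n) (s x (n + 1)) _).trans ?_
    have h1 := hclose n
    rw [dist_comm] at h1
    have h2 := hclose (n + 1)
    linarith
  · intro y
    refine ((Set.finite_singleton (y, 0)).union
      ((hcfin y).biUnion fun x _ => hsfin x)).subset ?_
    rintro ⟨x, n⟩ hz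
    simp only [Set.mem_ofPred_eq] at hz
    split_ifs at hz with hn
    · exact Or.inl (by simp [hn, hz])
    · exact Or.inr (Set.mem_biUnion (x := s x n) hz rfl)

/-! ### Partial isometries between orthonormal families, and their place in the Roe algebra. -/

section Transfer

open scoped ZeroAtInfty ComplexInnerProductSpace
open ContinuousLinearMap

variable {ι κ E : Type*} [NormedAddCommGroup E] [InnerProductSpace ℂ E] [CompleteSpace E]

/-- The isometry of `ℓ²(ι)` onto the closed span of an orthonormal family. -/
noncomputable def familyIsometry {b : ι → E} (hb : Orthonormal ℂ b) : L2 ι ℂ →ₗᵢ[ℂ] E :=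
  hb.orthogonalFamily.linearIsometry

theorem hasSum_familyIsometry {b : ι → E} (hb : Orthonormal ℂ b) (ξ : L2 ι ℂ) :
    HasSum (fun i => ξ i • b i) (familyIsometry hb ξ) :=
  hb.orthogonalFamily.hasSum_linearIsometry ξ

theorem adjoint_familyIsometry_apply {b : ι → E} (hb : Orthonormal ℂ b) (η : E) (i : ι) :
    adjoint (familyIsometry hb).toContinuousLinearMap η i = ⟪b i, η⟫ := by
  classical
  have h := lp.inner_single_left (𝕜 := ℂ) (G := fun _ : ι => ℂ) i (1 : ℂ)
    (adjoint (familyIsometry hb).toContinuousLinearMap η)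
  rw [adjoint_inner_right] at h
  have h1 : (familyIsometry hb).toContinuousLinearMap (lp.single 2 i (1 : ℂ)) = b i := by
    refine (hb.orthogonalFamily.linearIsometry_apply_single _).trans ?_
    simp
  rw [h1] at h
  simpa using h.symm

/-- The partial isometry that maps one orthonormal family to another and vanishes on the orthogonal
complement of the first. -/
noncomputable def transfer {b c : ι → E} (hb : Orthonormal ℂ b) (hc : Orthonormal ℂ c) :
    E →L[ℂ] E :=
  (familyIsometry hc).toContinuousLinearMap ∘L adjoint (familyIsometry hb).toContinuousLinearMap

theorem hasSum_transfer {b c : ι → E} (hb : Orthonormal ℂ b) (hc : Orthonormal ℂ c) (ξ : E) :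
    HasSum (fun i => ⟪b i, ξ⟫ • c i) (transfer hb hc ξ) := by
  have h := hasSum_familyIsometry hc (adjoint (familyIsometry hb).toContinuousLinearMap ξ)
  simp only [adjoint_familyIsometry_apply] at h
  exact h

theorem star_transfer {b c : ι → E} (hb : Orthonormal ℂ b) (hc : Orthonormal ℂ c) :
    star (transfer hb hc) = transfer hc hb := by
  rw [star_eq_adjoint, transfer, adjoint_comp, adjoint_adjoint, transfer]

theorem transfer_mul_transfer {b c d : ι → E} (hb : Orthonormal ℂ b) (hc : Orthonormal ℂ c)
    (hd : Orthonormal ℂ d) : transfer hc hd * transfer hb hc = transfer hb hd := by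
  have h : ∀ η, adjoint (familyIsometry hc).toContinuousLinearMap
      ((familyIsometry hc).toContinuousLinearMap η) = η := fun η =>
    DFunLike.congr_fun (LinearIsometry.adjoint_comp_self (familyIsometry hc)) η
  ext1 ξ
  simp only [transfer, mul_apply_eq_comp, ContinuousLinearMap.comp_apply, h]

theorem transfer_mul_transfer_of_orthogonal {b c : ι → E} {b' c' : κ → E} (hb : Orthonormal ℂ b)
    (hc : Orthonormal ℂ c) (hb' : Orthonormal ℂ b') (hc' : Orthonormal ℂ c')
    (h : ∀ i j, ⟪b i, c' j⟫ = 0) : transfer hb hc * transfer hb' hc' = 0 := by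
  have h0 : ∀ ξ i, ⟪b i, transfer hb' hc' ξ⟫ = 0 := by
    intro ξ i
    refine ((hasSum_transfer hb' hc' ξ).mapL (innerSL ℂ (b i))).unique ?_
    simp [h]
  ext1 ξ
  refine (hasSum_transfer hb hc (transfer hb' hc' ξ)).unique ?_
  simp only [h0, zero_smul]
  exact hasSum_zero

theorem isStarProjection_transfer {b : ι → E} (hb : Orthonormal ℂ b) :
    IsStarProjection (transfer hb hb) :=
  ⟨transfer_mul_transfer hb hb hb, star_transfer hb hb⟩

theorem transfer_add_transfer {b : ι → E} {b' : κ → E} {c : ι ⊕ κ → E} (hb : Orthonormal ℂ b)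
    (hb' : Orthonormal ℂ b') (hc : Orthonormal ℂ c) (h : c = Sum.elim b b') :
    transfer hb hb + transfer hb' hb' = transfer hc hc := by
  subst h
  ext1 ξ
  exact (HasSum.sum (f := fun i => ⟪Sum.elim b b' i, ξ⟫ • Sum.elim b b' i)
    (hasSum_transfer hb hb ξ) (hasSum_transfer hb' hb' ξ)).unique (hasSum_transfer hc hc ξ)

theorem transfer_reindex {b c : ι → E} (hb : Orthonormal ℂ b) (hc : Orthonormal ℂ c) (e : κ ≃ ι)
    (hb' : Orthonormal ℂ (b ∘ e)) (hc' : Orthonormal ℂ (c ∘ e)) :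
    transfer hb' hc' = transfer hb hc := by
  ext1 ξ
  exact (hasSum_transfer hb' hc' ξ).unique (e.hasSum_iff.2 (hasSum_transfer hb hc ξ))

variable {D H : Type*} [NormedAddCommGroup H] [InnerProductSpace ℂ H]

theorem opNorm_le_of_pointwise_norm_le {c : ℝ} (hc : 0 ≤ c) (A : L2 D H →L[ℂ] L2 D H)
    (hA : ∀ (ξ : L2 D H) (x : D), ‖A ξ x‖ ≤ c * ‖ξ x‖) : ‖A‖ ≤ c := by
  refine A.opNorm_le_bound hc fun ξ => ?_
  refine lp.norm_le_of_forall_sum_le (by simp) (by positivity) fun s => ?_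
  calc ∑ i ∈ s, ‖A ξ i‖ ^ (2 : ENNReal).toReal
      ≤ ∑ i ∈ s, c ^ (2 : ENNReal).toReal * ‖ξ i‖ ^ (2 : ENNReal).toReal := by
        refine Finset.sum_le_sum fun i _ => ?_
        rw [← Real.mul_rpow hc (norm_nonneg _)]
        exact Real.rpow_le_rpow (norm_nonneg _) (hA ξ i) (by simp)
    _ ≤ (c * ‖ξ‖) ^ (2 : ENNReal).toReal := by
        rw [← Finset.mul_sum, Real.mul_rpow hc (norm_nonneg _)]
        gcongr
        exact lp.sum_rpow_le_norm_rpow (by simp) ξ s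

theorem orthonormal_single {e : ℕ → H} (he : Orthonormal ℂ e) [DecidableEq D] {s : ι → D} {l : ι → ℕ}
    (h : Function.Injective fun i => (s i, l i)) :
    Orthonormal ℂ fun i => (lp.single 2 (s i) (e (l i)) : L2 D H) := by
  classical
  rw [orthonormal_iff_ite] at he ⊢
  intro i j
  rw [lp.inner_single_left]
  by_cases hs : s i = s j
  · rw [hs, lp.single_apply_self, he]
    exact if_congr ⟨fun hl => h (Prod.ext hs hl), fun hij => congrArg l hij⟩ rfl rfl
  · rw [lp.single_apply_ne _ _ _ hs, inner_zero_right, if_neg fun hij => hs (congrArg s hij)]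

/-- This puts `i_D(1) = V_D V_D*` in the form of a `transfer`, so that the calculus of orthonormal
families applies to it. -/
theorem ampl_eq_familyIsometry [CompleteSpace H] [DecidableEq D] (V : ℂ →ₗᵢ[ℂ] H)
    (hb : Orthonormal ℂ fun x : D => (lp.single 2 x (V 1) : L2 D H)) :
    ampl D V = (familyIsometry hb).toContinuousLinearMap := by
  ext1 ξ
  refine (lp.hasSum_single (by simp) (ampl D V ξ)).unique ?_
  have h : ∀ x, (lp.single 2 x (ampl D V ξ x) : L2 D H) = ξ x • lp.single 2 x (V 1) := fun x => by
    rw [ampl_apply, ← lp.single_smul, ← map_smul, smul_eq_mul, mul_one]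
  simp only [h]
  exact hasSum_familyIsometry hb ξ

variable [MetricSpace D] [DiscreteTopology D]

/-- The projection of `ℓ²(D; H)` onto the functions supported at a point. -/
noncomputable def pointProj (x : D) : L2 D H →L[ℂ] L2 D H := mulOp (pointFun x)

theorem pointProj_apply [DecidableEq D] (x y : D) (ξ : L2 D H) :
    pointProj x ξ y = if y = x then ξ y else 0 := by
  change Set.indicator {x} (1 : D → ℂ) y • ξ y = _
  split_ifs with h
  · subst h; simp
  · rw [Set.indicator_of_notMem (by exact h), zero_smul]

variable [CompleteSpace H]

/-- To check that `f T` is compact for all `f ∈ C₀(D)`, it suffices to consider points. -/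
theorem isCompactOperator_mulOp_mul {T : L2 D H →L[ℂ] L2 D H}
    (hT : ∀ x, IsCompactOperator (pointProj x * T : L2 D H →L[ℂ] L2 D H)) (f : C₀(D, ℂ)) :
    IsCompactOperator (mulOp f * T : L2 D H →L[ℂ] L2 D H) := by
  classical
  have hcl := isClosed_setOfPred_isCompactOperator (𝕜₁ := ℂ) (𝕜₂ := ℂ) (σ₁₂ := RingHom.id ℂ)
    (M₁ := L2 D H) (M₂ := L2 D H)
  refine hcl.closure_subset (Metric.mem_closure_iff.2 fun ε hε => ?_)
  -- Truncating `f` to the finite set where `‖f x‖ ≥ δ` changes `f T` by at most `δ ‖T‖`. The `+ 1`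
  -- avoids division by zero and makes the final inequality strict.
  set δ := ε / (‖T‖ + 1) with hδ
  have hδ0 : 0 < δ := by positivity
  have hfin : {x | δ ≤ ‖f x‖}.Finite := by
    have h := (zero_at_infty f).eventually (Metric.ball_mem_nhds 0 hδ0)
    rw [Filter.Eventually, Filter.mem_cocompact] at h
    obtain ⟨K, hK, hKs⟩ := h
    refine hK.finite_of_discrete.subset fun x hx => ?_
    by_contra hxK
    have := hKs hxK
    simp only [dist_zero_right, Set.mem_ofPred_eq] at this hx
    linarith
  refine ⟨∑ x ∈ hfin.toFinset, f x • (pointProj x * T), ?_, ?_⟩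
  · exact Submodule.sum_mem (compactOperator (RingHom.id ℂ) (L2 D H) (L2 D H))
      fun x _ => Submodule.smul_mem _ _ (hT x)
  · have hsum : ∑ x ∈ hfin.toFinset, f x • (pointProj x * T) =
        (∑ x ∈ hfin.toFinset, f x • (pointProj x : L2 D H →L[ℂ] L2 D H)) * T := by
      simp only [Finset.sum_mul, smul_mul_assoc]
    rw [dist_eq_norm, hsum, ← sub_mul]
    have hle : ‖mulOp f - ∑ x ∈ hfin.toFinset, f x • (pointProj x : L2 D H →L[ℂ] L2 D H)‖ ≤ δ := by
      refine opNorm_le_of_pointwise_norm_le hδ0.le _ fun ξ x => ?_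
      have hval : (∑ y ∈ hfin.toFinset, f y • (pointProj y : L2 D H →L[ℂ] L2 D H)) ξ x =
          if x ∈ hfin.toFinset then f x • ξ x else 0 := by
        rw [sum_apply, lp.coeFn_sum, Finset.sum_apply]
        have : ∀ y, ((f y • (pointProj y : L2 D H →L[ℂ] L2 D H)) ξ) x =
            if x = y then f x • ξ x else 0 := by
          intro y
          change f y • pointProj y ξ x = _
          rw [pointProj_apply]
          split_ifs with hxy
          · rw [hxy]
          · rw [smul_zero]
        rw [Finset.sum_congr rfl fun y _ => this y, Finset.sum_ite_eq]
      change ‖mulOp f ξ x - (∑ y ∈ hfin.toFinset,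
        f y • (pointProj y : L2 D H →L[ℂ] L2 D H)) ξ x‖ ≤ _
      rw [hval, mulOp_apply]
      split_ifs with hx
      · simp only [sub_self, norm_zero]
        positivity
      · rw [sub_zero, norm_smul]
        have : ‖f x‖ < δ := by simpa using hx
        gcongr
    calc _ ≤ δ * ‖T‖ := (norm_mul_le _ _).trans (by gcongr)
      _ < δ * (‖T‖ + 1) := by gcongr; linarith
      _ = ε := by rw [hδ]; field_simp

variable [DecidableEq D] {s s' : ι → D} {g g' : ι → H} {b c : ι → L2 D H}

/-- Cutting the range down to one point `x` leaves only the finitely many terms with `s' i = x`,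
each of rank at most one. -/
theorem isCompactOperator_mulOp_mul_transfer (hb : Orthonormal ℂ b) (hc : Orthonormal ℂ c)
    (hcs : ∀ i, c i = lp.single 2 (s' i) (g' i)) (hs' : ∀ x, {i | s' i = x}.Finite)
    (f : C₀(D, ℂ)) : IsCompactOperator (mulOp f * transfer hb hc : L2 D H →L[ℂ] L2 D H) := by
  refine isCompactOperator_mulOp_mul (fun x => ?_) f
  have h : pointProj x * transfer hb hc =
      ∑ i ∈ (hs' x).toFinset, (toSpanSingleton ℂ (c i)) ∘L (innerSL ℂ (b i)) := by
    ext1 ξ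
    refine ((hasSum_transfer hb hc ξ).mapL (pointProj x)).unique ?_
    have hval : ∀ i, pointProj x (⟪b i, ξ⟫ • c i) = if s' i = x then ⟪b i, ξ⟫ • c i else 0 := by
      intro i
      rw [map_smul]
      ext y
      rw [lp.coeFn_smul, Pi.smul_apply, pointProj_apply, hcs]
      by_cases hy : y = x
      · by_cases hi : s' i = x
        · rw [if_pos hy, if_pos hi]; rfl
        · rw [if_pos hy, if_neg hi, lp.single_apply_ne _ _ _ (by rw [hy]; exact Ne.symm hi),
            smul_zero]; rfl
      · by_cases hi : s' i = x
        · rw [if_neg hy, if_pos hi, lp.coeFn_smul, Pi.smul_apply,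
            lp.single_apply_ne _ _ _ (by rw [hi]; exact hy)]
        · rw [if_neg hy, if_neg hi, smul_zero]; rfl
    simp only [hval]
    have h2 : (∑ i ∈ (hs' x).toFinset, (toSpanSingleton ℂ (c i)) ∘L (innerSL ℂ (b i))) ξ =
        ∑ i ∈ (hs' x).toFinset, if s' i = x then ⟪b i, ξ⟫ • c i else 0 := by
      rw [sum_apply]
      refine Finset.sum_congr rfl fun i hi => ?_
      rw [if_pos (by simpa using hi)]
      rfl
    rw [h2]
    exact hasSum_sum_of_ne_finset_zero fun i hi => if_neg (by simpa using hi)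
  rw [h]
  exact Submodule.sum_mem (compactOperator (RingHom.id ℂ) (L2 D H) (L2 D H)) fun i _ =>
    (isCompactOperator_of_locallyCompactSpace_rng (toSpanSingleton ℂ (c i))).comp_clm _

/-- Finite fibres of `s` and `s'` give local compactness on the two sides, and the bound on `dist (s
i) (s' i)` limits propagation. -/
theorem transfer_mem_algebraicRoe (hb : Orthonormal ℂ b) (hc : Orthonormal ℂ c)
    (hbs : ∀ i, b i = lp.single 2 (s i) (g i)) (hcs : ∀ i, c i = lp.single 2 (s' i) (g' i))
    (hs : ∀ x, {i | s i = x}.Finite) (hs' : ∀ x, {i | s' i = x}.Finite) {R : ℝ}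
    (hR : ∀ i, dist (s i) (s' i) ≤ R) : transfer hb hc ∈ algebraicRoe D H := by
  refine ⟨fun f => ⟨?_, isCompactOperator_mulOp_mul_transfer hb hc hcs hs' f⟩, ?_⟩
  -- The adjoint of a transfer is the transfer with the families swapped, so the right-hand case
  -- follows from the left-hand one.
  · have h := isCompactOperator_adjoint
      (isCompactOperator_mulOp_mul_transfer hc hb hbs hs (star f))
    rw [← star_eq_adjoint, star_mul, star_transfer, mulOp_adjoint, star_star] at h
    exact h
  · rw [finitePropagation_iff]
    -- `R` need not be positive (it is `0` for a projection), while the propagation bound must be.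
    refine ⟨max R 1, by positivity, fun ξ x hξ => ?_⟩
    refine ((hasSum_transfer hb hc ξ).mapL (lp.evalCLM ℂ (fun _ : D => H) 2 x)).unique ?_
    convert hasSum_zero with i
    change ⟪b i, ξ⟫ • c i x = 0
    by_cases hx : s' i = x
    · rw [hbs, lp.inner_single_left, hξ, inner_zero_right, zero_smul]
      rw [← hx, dist_comm]
      exact (hR i).trans (le_max_left _ _)
    · rw [hcs, lp.single_apply_ne _ _ _ (Ne.symm hx), smul_zero]

theorem coe_roeInclusion_roeUnit (V : ℂ →ₗᵢ[ℂ] H)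
    (hb : Orthonormal ℂ fun x : D => (lp.single 2 x (V 1) : L2 D H)) :
    (roeInclusion D V (roeUnit D) : L2 D H →L[ℂ] L2 D H) = transfer hb hb := by
  change ampl D V ∘L 1 ∘L adjoint (ampl D V) = _
  rw [ampl_eq_familyIsometry V hb]
  rfl

end Transfer

/-! ### The swindle in the Roe algebra. -/

theorem K0.cls_eq_zero_of_absorbed_of_mem {A : Type*} [NonUnitalRing A] [StarRing A] [Module ℂ A]
    [IsScalarTower ℂ A A] [SMulCommClass ℂ A A] [StarModule ℂ A]
    {S : NonUnitalStarSubalgebra ℂ A} {p : S} (hp : IsStarProjection p) {q v : A} (hqS : q ∈ S)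
    (hvS : v ∈ S) (hq : IsStarProjection q) (hpq : p * q = 0) (hv : star v * v = p + q)
    (hv' : v * star v = q) : K0.cls p hp = 0 :=
  K0.cls_eq_zero_of_absorbed (q := ⟨q, hqS⟩) (v := ⟨v, hvS⟩) hp
    ⟨Subtype.ext hq.isIdempotentElem.eq, Subtype.ext hq.isSelfAdjoint.star_eq⟩
    (Subtype.ext hpq) (Subtype.ext hv) (Subtype.ext hv')

/-- The unit vector extends to a Hilbert basis, which is infinite because `H` is
infinite-dimensional; an injective sequence in the basis can start at `w`. -/
theorem exists_orthonormal_sequence {H : Type*} [NormedAddCommGroup H] [InnerProductSpace ℂ H]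
    [CompleteSpace H] (hH : ¬ FiniteDimensional ℂ H) {w : H} (hw : ‖w‖ = 1) :
    ∃ e : ℕ → H, Orthonormal ℂ e ∧ e 0 = w := by
  have hsing : Orthonormal ℂ ((↑) : ({w} : Set H) → H) :=
    ⟨fun x => by rw [x.2, hw], fun x y h => absurd (Subsingleton.elim x y) h⟩
  obtain ⟨S, B, hS, hB⟩ := hsing.exists_hilbertBasis_extension
  have hinf : S.Infinite := by
    intro hfin
    have := hfin.fintype
    exact hH (Module.Basis.finiteDimensional_of_finite B.toOrthonormalBasis.toBasis)
  have hinf' := hinf.sdiff (Set.finite_singleton w)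
  let E := hinf'.natEmbedding
  let e : ℕ → S := fun n => n.casesOn ⟨w, hS rfl⟩ fun n => ⟨E n, (E n).2.1⟩
  have he : Function.Injective e := by
    rintro (_ | m) (_ | n) h
    · rfl
    · exact absurd (congrArg (fun y : S => (y : H)) h).symm (E n).2.2
    · exact absurd (congrArg (fun y : S => (y : H)) h) (E m).2.2
    · have : E m = E n := Subtype.ext (congrArg (fun y : S => (y : H)) h)
      rw [E.injective this]
  refine ⟨Subtype.val ∘ e, ?_, rfl⟩
  have := B.orthonormal.comp e he
  rwa [hB] at this

/-- Labels separate the paths passing through a common point, so that `δ_{t z} ⊗ e_{lab z}` becomes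
an orthonormal family. Each fibre of `t` is countable and hence injects into `ℕ`. -/
theorem exists_label {D : Type*} {t : D → ℕ → D} (ht0 : ∀ x, t x 0 = x)
    (htfin : ∀ y, {z : D × ℕ | t z.1 z.2 = y}.Finite) :
    ∃ lab : D × ℕ → ℕ, (∀ x, lab (x, 0) = 0) ∧
      Function.Injective fun z => (t z.1 z.2, lab z) := by
  have hlab : ∀ y, ∃ l : D × ℕ → ℕ, Set.InjOn l {z | t z.1 z.2 = y} := fun y =>
    Set.countable_iff_exists_injOn.1 (htfin y).countable
  choose l hl using hlab
  let s : D × ℕ → D := fun z => t z.1 z.2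
  -- The shift by one reserves label `0` for the starting points, where the vector must be `V 1`.
  let lab : D × ℕ → ℕ := fun z => if z.2 = 0 then 0 else l (s z) z + 1
  refine ⟨lab, fun x => rfl, ?_⟩
  rintro ⟨x, n⟩ ⟨y, m⟩ h
  obtain ⟨h1, h2⟩ := Prod.mk.inj h
  by_cases hn : n = 0 <;> by_cases hm : m = 0
  · subst hn hm
    simp only [ht0] at h1
    rw [h1]
  · simp [lab, hn, hm] at h2
  · simp [lab, hn, hm] at h2
  · simp only [lab, hn, hm, if_false, Nat.add_right_cancel_iff] at h2
    change s (x, n) = s (y, m) at h1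
    rw [← h1] at h2
    exact hl (s (x, n)) rfl h1.symm h2

theorem roeUnit_cls_eq_zero {D : Type*} [MetricSpace D] [DiscreteTopology D] {H : Type*}
    [NormedAddCommGroup H] [InnerProductSpace ℂ H] [CompleteSpace H] (V : ℂ →ₗᵢ[ℂ] H)
    {e : ℕ → H} (he : Orthonormal ℂ e) (he0 : e 0 = V 1) {t : D → ℕ → D} {R : ℝ}
    (ht0 : ∀ x, t x 0 = x) (htR : ∀ x n, dist (t x n) (t x (n + 1)) ≤ R)
    (htfin : ∀ y, {z : D × ℕ | t z.1 z.2 = y}.Finite) {lab : D × ℕ → ℕ}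
    (hlab0 : ∀ x, lab (x, 0) = 0) (hinj : Function.Injective fun z => (t z.1 z.2, lab z)) :
    K0.map (roeInclusion D V) (K0.cls (roeUnit D) (isStarProjection_roeUnit D)) = 0 := by
  classical
  -- The shift on indices: its image omits exactly the pairs `(x, 0)`, which index the range of
  -- `i_D(1)`.
  let σ : D × ℕ → D × ℕ := fun z => (z.1, z.2 + 1)
  have hσ : Function.Injective σ := by
    rintro ⟨x, n⟩ ⟨y, m⟩ h
    simpa [σ] using h
  have hb := orthonormal_single (H := H) he hinj
  set b : D × ℕ → L2 D H := fun z => lp.single 2 (t z.1 z.2) (e (lab z)) with hbdef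
  have hb1 : Orthonormal ℂ (b ∘ σ) := hb.comp σ hσ
  have hb0' : (fun x => b (x, 0)) = fun x : D => (lp.single 2 x (V 1) : L2 D H) := by
    funext x
    simp [b, ht0, hlab0, he0]
  have hb0 : Orthonormal ℂ fun x : D => (lp.single 2 x (V 1) : L2 D H) := by
    rw [← hb0']
    exact hb.comp _ fun x y h => (Prod.mk.inj h).1
  let eqv : D ⊕ D × ℕ ≃ D × ℕ := Equiv.ofBijective (Sum.elim (fun x => (x, 0)) σ) (by
    constructor
    · rintro (x | x) (y | y) h <;> simp_all [σ, Prod.ext_iff]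
    · rintro ⟨x, _ | n⟩
      · exact ⟨Sum.inl x, rfl⟩
      · exact ⟨Sum.inr (x, n), rfl⟩)
  have hbe : Orthonormal ℂ (b ∘ eqv) := hb.comp _ eqv.injective
  have hadd : transfer hb0 hb0 + transfer hb1 hb1 = transfer hb hb := by
    rw [← transfer_reindex hb hb eqv hbe hbe]
    refine transfer_add_transfer hb0 hb1 hbe ?_
    funext z
    rcases z with x | z
    · exact congrFun hb0' x
    · rfl
  have horth : transfer hb0 hb0 * transfer hb1 hb1 = 0 := by
    refine transfer_mul_transfer_of_orthogonal hb0 hb0 hb1 hb1 fun x z => ?_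
    rw [← congrFun hb0' x]
    exact hb.2 fun h => by simp [σ, Prod.ext_iff] at h
  have hfin1 : ∀ y, {z | t (σ z).1 (σ z).2 = y}.Finite := fun y => (htfin y).preimage hσ.injOn
  have hq : transfer hb1 hb1 ∈ roeAlgebra D H :=
    NonUnitalStarSubalgebra.le_topologicalClosure _
      (transfer_mem_algebraicRoe hb1 hb1 (fun _ => rfl) (fun _ => rfl) hfin1 hfin1
        (R := 0) fun z => (dist_self _).le)
  -- The partial isometry `v` moves each path one step forward, so its propagation is controlled by
  -- the step length `R`.
  have hv : transfer hb hb1 ∈ roeAlgebra D H :=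
    NonUnitalStarSubalgebra.le_topologicalClosure _
      (transfer_mem_algebraicRoe hb hb1 (fun _ => rfl) (fun _ => rfl) htfin hfin1
        fun z => htR z.1 z.2)
  have hp := coe_roeInclusion_roeUnit V hb0
  have hpp : IsStarProjection (roeInclusion D V (roeUnit D)) :=
    (isStarProjection_roeUnit D).map _
  rw [K0.map_cls _ _ _ hpp]
  refine K0.cls_eq_zero_of_absorbed_of_mem hpp hq hv (isStarProjection_transfer hb1) ?_ ?_ ?_
  · rw [hp, horth]
  · rw [hp, hadd, star_transfer, transfer_mul_transfer]
  · rw [star_transfer, transfer_mul_transfer]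

end CoarseK

theorem corollary3p4
    (D : Type*) [MetricSpace D] [CoarseK.UniformlyDiscrete D] (hbg : CoarseK.BoundedGeometry D)
    (hD : CoarseK.NoFiniteComponents D ∨ CoarseK.EmbedsInRaySpace D)
    (H : Type*) [NormedAddCommGroup H] [InnerProductSpace ℂ H] [CompleteSpace H]
    (hH : ¬ FiniteDimensional ℂ H) (V : ℂ →ₗᵢ[ℂ] H) :
    CoarseK.K0.map (CoarseK.roeInclusion D V)
      (CoarseK.K0.cls (CoarseK.roeUnit D) (CoarseK.isStarProjection_roeUnit D)) = 0 := by
  classical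
  obtain ⟨t, R, ht0, htR, htfin⟩ := hD.elim (fun h => h.hasEscape hbg) fun h => h.hasEscape
  obtain ⟨e, he, he0⟩ := CoarseK.exists_orthonormal_sequence hH
    (show ‖V 1‖ = 1 by rw [V.norm_map, norm_one])
  obtain ⟨lab, hlab0, hinj⟩ := CoarseK.exists_label ht0 htfin
  exact CoarseK.roeUnit_cls_eq_zero V he he0 ht0 htR htfin hlab0 hinj
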